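/- Let $M$ be an oriented smooth (Hausdorff, $\sigma$-compact) manifold of dimension $n\ge 1$ without boundary, with tangent bundle $\pi:TM\to M$. Let $U\subset TM\setminus\{0\}$ be a conic sub-bundle of full dimension $2n$: $\pi(U)=M$; $\lambda u\in U$ for all $u\in U$ and $\lambda\neq 0$; and $U$ is open in $TM$ or, more generally, a domain with smooth boundary transverse to the fibres (near each of its points $U=\{f\ge 0\}$ with $f$ smooth and with non-zero derivative along the fibre wherever $f=0$). Let $\mathcal R=\dot x^\mu\partial/\partial\dot x^\mu$ be the radial vector field. A *Vlasov field* on $U$ is a smooth vector field $W$ on $U$ with $\pi_*(W|_u)=u$ and $W\langle\dot h\rangle|_{\lambda u}=\lambda^2W\langle\dot h\rangle|_u$ for all $u\in U$, $\lambda>0$ and $h\in C^\infty(M)$, where $\dot h(u)=u\langle h\rangle$. A *Vlasov bivector* is a bivector field $\Psi=\mathcal R\wedge W$ with $W$ a Vlasov field. A smooth $(2n-2)$-form $\theta$ on $U$ satisfies the *transport equations* for $\Psi$ if $d\theta=0$ and $i_X\theta=i_Y\theta=0$ whenever $\Psi=X\wedge Y$ with $X,Y$ smooth vector fields on $U$.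 A *support form* is a smooth $1$-form $\chi$ on $U$ such that for every $u\in U$ the pullback of $\chi$ along the ray $(0,\infty)\to U$, $\lambda\mapsto\lambda u$, has compact support and integral $1$. For a $(2n-1)$-form $\alpha$ on $U$, a smooth $(n-1)$-form $J$ on $M$ is the *integral of $\alpha$ along the fibres*, $J=\pi_\varsigma\alpha$, if for every compactly supported smooth $1$-form $\beta$ on $M$ the integral $\int_U\pi^*\beta\wedge\alpha$ converges absolutely and $$\int_U\pi^*\beta\wedge\alpha=\int_M\beta\wedge J ,$$ where $TM$ carries the orientation of $dx^1\wedge\dots\wedge dx^n\wedge d\dot x^1\wedge\dots\wedge d\dot x^n$. We say that $\alpha$ has *vertically compact support* if for every compact $C\subset M$ there is a compact $K\subset U$ such that $\alpha$ vanishes at all points of $\pi^{-1}(C)\cap U$ outside $K$. **Lemma.** Let $\Psi$ be a Vlasov bivector on $U$ and let $\theta$ satisfy the transport equations for $\Psi$. Then the current $\mathcal J=\pi_\varsigma(\chi\wedge\theta)$ does not depend on the choice of the support form $\chi$. That is, let $\chi,\chi'$ be support forms on $U$. If $J=\pi_\varsigma(\chi\wedge\theta)$ and $J'=\pi_\varsigma(\chi'\wedge\theta)$,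 then $J=J'$. Moreover, if $\chi\wedge\theta$ and $\chi'\wedge\theta$ have vertically compact support, then a smooth $(n-1)$-form $J$ on $M$ satisfies $J=\pi_\varsigma(\chi\wedge\theta)$ if and only if it satisfies $J=\pi_\varsigma(\chi'\wedge\theta)$. -/

import Mathlib

open Set MeasureTheory
open scoped Manifold ContDiff Topology

noncomputable section

namespace VlasovCurrent

/-! ### Differential forms on manifolds -/

section Forms

variable {V : Type*} [AddCommGroup V] [Module ℝ V] [TopologicalSpace V]

/-- The wedge product `α ∧ η` of a `1`-form and a `k`-form on a vector space:
`(α ∧ η)(v₀, …, v_k) = ∑ i, (-1)^i α(v_i) η(v₀, …, v_{i-1}, v_{i+1}, …, v_k)`. -/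
def wedgeOne {k : ℕ} (α : V [⋀^Fin 1]→L[ℝ] ℝ) (η : V [⋀^Fin k]→L[ℝ] ℝ) :
    V [⋀^Fin (k + 1)]→L[ℝ] ℝ where
  toAlternatingMap := AlternatingMap.alternatizeUncurryFin
    (((ContinuousAlternatingMap.ofSubsingleton ℝ V ℝ (0 : Fin 1)).symm α).toLinearMap.smulRight
      η.toAlternatingMap)
  cont := by
    have h : Continuous fun v : Fin (k + 1) → V =>
        ∑ i : Fin (k + 1), (-1 : ℤ) ^ (i : ℕ) • (α (fun _ => v i) * η (i.removeNth v)) := by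
      refine continuous_finsetSum _ fun i _ => (continuous_zsmul _).comp ?_
      refine Continuous.mul (α.cont.comp (by fun_prop)) (η.cont.comp ?_)
      exact continuous_pi fun j => continuous_apply _
    convert h using 2 with v
    simp [AlternatingMap.alternatizeUncurryFin_apply]

/-- `i_X η = 0` for a `k`-form `η` on a vector space (for `k = 0` this always holds). -/
def InteriorZero {k : ℕ} (X : V) (η : V [⋀^Fin k]→L[ℝ] ℝ) : Prop :=
  ∀ v : Fin k → V, (∃ i, v i = X) → η v = 0

variable {E : Type*} [NormedAddCommGroup E] [NormedSpace ℝ E] {H : Type*} [TopologicalSpace H]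

/-- Differential `k`-forms (not necessarily smooth) on a manifold `N` modelled on `I`. -/
abbrev DForm (I : ModelWithCorners ℝ E H) (N : Type*) [TopologicalSpace N] [ChartedSpace H N]
    (k : ℕ) : Type _ :=
  ∀ x : N, TangentSpace I x [⋀^Fin k]→L[ℝ] ℝ

variable {I : ModelWithCorners ℝ E H} {N : Type*} [TopologicalSpace N] [ChartedSpace H N] {k : ℕ}

/-- The coordinate expression of a form in the preferred chart at `c`, that is, its pullback along
the inverse of the chart (meaningful on the target of the chart). -/
def DForm.inChart (η : DForm I N k) (c : N) (y : E) : E [⋀^Fin k]→L[ℝ] ℝ :=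
  (η ((extChartAt I c).symm y)).compContinuousLinearMap
    (mfderiv 𝓘(ℝ, E) I (extChartAt I c).symm y)

variable (I) in
/-- The coordinate image, in the preferred chart at `c`, of a subset `U` of the manifold. -/
def chartImage (c : N) (U : Set N) : Set E :=
  (extChartAt I c).target ∩ (extChartAt I c).symm ⁻¹' U

/-- `η` is a smooth form on `U` (up to the boundary, when `U` is a domain with boundary). -/
def DForm.SmoothOn (η : DForm I N k) (U : Set N) : Prop :=
  ∀ c : N, ContDiffOn ℝ ∞ (η.inChart c) (chartImage I c U)

/-- `dη = 0` on `U`. -/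
def DForm.ClosedOn (η : DForm I N k) (U : Set N) : Prop :=
  ∀ c : N, ∀ y ∈ chartImage I c U, extDerivWithin (η.inChart c) (chartImage I c U) y = 0

/-- The pointwise wedge product of a `1`-form field and a `k`-form field. -/
def DForm.wedge (α : DForm I N 1) (η : DForm I N k) : DForm I N (k + 1) :=
  fun x => wedgeOne (α x) (η x)

/-- `X` is a smooth vector field on `U`. -/
def SmoothVectorField (X : ∀ x : N, TangentSpace I x) [IsManifold I 1 N] (U : Set N) : Prop :=
  ContMDiffOn I I.tangent ∞ (fun x => (⟨x, X x⟩ : TangentBundle I N)) U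

/-- The simple bivector `X ∧ Y` at a point. -/
def bivector {x : N} (X Y : TangentSpace I x) : ⋀[ℝ]^2 (TangentSpace I x) :=
  exteriorPower.ιMulti ℝ 2 ![X, Y]

/-- The null condition `Null(Φ, η)` on `U` for a bivector field `Φ` and a form `η`:
`i_X η = i_Y η = 0` on `U` whenever `Φ = X ∧ Y` on `U` with `X`, `Y` smooth vector fields. -/
def NullCondition [IsManifold I 1 N] (U : Set N) (Φ : ∀ x : N, ⋀[ℝ]^2 (TangentSpace I x))
    (η : DForm I N k) : Prop :=
  ∀ X Y : ∀ x : N, TangentSpace I x, SmoothVectorField X U → SmoothVectorField Y U →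
    (∀ x ∈ U, Φ x = bivector (X x) (Y x)) →
    ∀ x ∈ U, InteriorZero (X x) (η x) ∧ InteriorZero (Y x) (η x)

end Forms

/-! ### Geometry of the tangent bundle

The base manifold `M` has dimension `n = d + 1`. -/

/-- The model space `ℝⁿ`, `n = d + 1`. -/
abbrev Model (d : ℕ) : Type := EuclideanSpace ℝ (Fin (d + 1))

section Tangent

variable {d : ℕ} {M : Type*} [TopologicalSpace M] [ChartedSpace (Model d) M]
  [IsManifold (𝓡 (d + 1)) ∞ M]

variable (d M) in
/-- The tangent bundle `TM`. -/
abbrev TM : Type _ := TangentBundle (𝓡 (d + 1)) M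

instance instIsManifoldTM : IsManifold (𝓡 (d + 1)).tangent ∞ (TM d M) := by
  have : IsManifold (𝓡 (d + 1)) (∞ + 1) M := by simpa using ‹IsManifold (𝓡 (d + 1)) ∞ M›
  infer_instance

instance instIsManifoldOneTM : IsManifold (𝓡 (d + 1)).tangent 1 (TM d M) :=
  IsManifold.of_le (n := ∞) (by simp)

/-- The vertical lift to `u` of a vector `v` tangent to `M` at the base point of `u`: the velocity
at `t = 0` of the curve `t ↦ u + t v` in the fibre. -/
def verticalLift (u : TM d M) (v : TangentSpace (𝓡 (d + 1)) u.proj) :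
    TangentSpace (𝓡 (d + 1)).tangent u :=
  mfderiv 𝓘(ℝ, Model d) (𝓡 (d + 1)).tangent
    (fun w : Model d => (⟨u.proj, w⟩ : TM d M)) (u.snd : Model d) v

/-- The radial vector field `R = ẋ^μ ∂/∂ẋ^μ`. -/
def radial (u : TM d M) : TangentSpace (𝓡 (d + 1)).tangent u :=
  verticalLift u u.snd

/-- Scalar multiplication in the fibres of `TM`. -/
def scale (c : ℝ) (u : TM d M) : TM d M := ⟨u.proj, c • u.snd⟩

/-- The scalar lift `ḣ(u) = u⟨h⟩` of a function `h` on `M`. -/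
def scalarLift (h : M → ℝ) (u : TM d M) : ℝ :=
  mfderiv (𝓡 (d + 1)) 𝓘(ℝ, ℝ) h u.proj u.snd

/-- The action `X⟨F⟩` at `u` of a tangent vector `X` of `TM` on a function `F` on `TM`. -/
def vectorAct {u : TM d M} (X : TangentSpace (𝓡 (d + 1)).tangent u) (F : TM d M → ℝ) : ℝ :=
  mfderiv (𝓡 (d + 1)).tangent 𝓘(ℝ, ℝ) F u X

/-- A conic sub-bundle of the slit tangent bundle, of full dimension, possibly with boundary. -/
structure IsConicSubbundle (U : Set (TM d M)) : Prop where
  slit : ∀ u ∈ U, u.snd ≠ 0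
  surjective : ∀ p : M, ∃ u ∈ U, u.proj = p
  conic : ∀ u ∈ U, ∀ c : ℝ, c ≠ 0 → scale c u ∈ U
  /-- Near each of its points `U` is given by `f ≥ 0`, where `f` is smooth and has non-zero
  derivative along the fibre wherever it vanishes (`f = 1` if `U` is open). -/
  smooth : ∀ u ∈ U, ∃ V : Set (TM d M), IsOpen V ∧ u ∈ V ∧ ∃ f : TM d M → ℝ,
    ContMDiffOn (𝓡 (d + 1)).tangent 𝓘(ℝ, ℝ) ∞ f V ∧ U ∩ V = {w ∈ V | 0 ≤ f w} ∧
    ∀ w ∈ V, f w = 0 → ∃ v : TangentSpace (𝓡 (d + 1)) w.proj, vectorAct (verticalLift w v) f ≠ 0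

/-- A Vlasov field on `U`: a smooth vector field that is horizontal and radially quadratic. -/
structure IsVlasovField (U : Set (TM d M))
    (W : ∀ u : TM d M, TangentSpace (𝓡 (d + 1)).tangent u) : Prop where
  smooth : SmoothVectorField W U
  horizontal : ∀ u ∈ U,
    mfderiv (𝓡 (d + 1)).tangent (𝓡 (d + 1)) (fun w : TM d M => w.proj) u (W u) = u.snd
  quadratic : ∀ h : M → ℝ, ContMDiff (𝓡 (d + 1)) 𝓘(ℝ, ℝ) ∞ h → ∀ u ∈ U, ∀ c : ℝ, 0 < c →
    vectorAct (W (scale c u)) (scalarLift h) = c ^ 2 * vectorAct (W u) (scalarLift h)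

/-- A Vlasov bivector on `U`: a bivector field of the form `R ∧ W` with `W` a Vlasov field.
(Such a bivector field is simple, radial and horizontal.) -/
def IsVlasovBivector (U : Set (TM d M))
    (Ψ : ∀ u : TM d M, ⋀[ℝ]^2 (TangentSpace (𝓡 (d + 1)).tangent u)) : Prop :=
  ∃ W : ∀ u : TM d M, TangentSpace (𝓡 (d + 1)).tangent u,
    IsVlasovField U W ∧ ∀ u ∈ U, Ψ u = bivector (radial u) (W u)

/-- The transport equations on `U` for a `(2n-2)`-form `θ` (note `2n - 2 = 2d`). -/
structure TransportEquations (U : Set (TM d M))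
    (Ψ : ∀ u : TM d M, ⋀[ℝ]^2 (TangentSpace (𝓡 (d + 1)).tangent u))
    (θ : DForm (𝓡 (d + 1)).tangent (TM d M) (2 * d)) : Prop where
  null : NullCondition U Ψ θ
  closed : θ.ClosedOn U

/-- The coefficient, with respect to `dc`, of the pullback of `χ` along the ray
`(0, ∞) → U`, `c ↦ c u`. -/
def rayCoeff (χ : DForm (𝓡 (d + 1)).tangent (TM d M) 1) (u : TM d M) (c : ℝ) : ℝ :=
  χ (scale c u) fun _ => verticalLift (scale c u) u.snd

/-- A support form: a smooth `1`-form on `U` whose pullback to every ray has compact support and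
integral one. -/
structure IsSupportForm (U : Set (TM d M)) (χ : DForm (𝓡 (d + 1)).tangent (TM d M) 1) :
    Prop where
  smooth : χ.SmoothOn U
  compactSupport : ∀ u ∈ U, HasCompactSupport fun c : Ioi (0 : ℝ) => rayCoeff χ u c
  integral_eq_one : ∀ u ∈ U, ∫ c in Ioi (0 : ℝ), rayCoeff χ u c = 1

/-- The pullback `π^* β` of a form along `π : TM → M`. -/
def pullbackProj {k : ℕ} (β : DForm (𝓡 (d + 1)) M k) : DForm (𝓡 (d + 1)).tangent (TM d M) k :=
  fun u => (β u.proj).compContinuousLinearMap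
    (mfderiv (𝓡 (d + 1)).tangent (𝓡 (d + 1)) (fun w : TM d M => w.proj) u)

/-- `α` has vertically compact support in `U`, locally uniformly in the base point: over a compact
subset of `M` the support of `α` lies in a compact subset of `U`. -/
def VerticalCompactSupport {k : ℕ} (U : Set (TM d M))
    (α : DForm (𝓡 (d + 1)).tangent (TM d M) k) : Prop :=
  ∀ C : Set M, IsCompact C → ∃ K : Set (TM d M), IsCompact K ∧ K ⊆ U ∧
    ∀ u ∈ U, u.proj ∈ C → α u ≠ 0 → u ∈ K

/-! ### Integration of top-degree forms and integration along the fibre -/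

/-- The standard frame of `ℝⁿ`. -/
def frame (d : ℕ) : Fin (d + 1) → Model d := fun i => EuclideanSpace.single i 1

/-- The frame `∂/∂x^1, …, ∂/∂x^n, ∂/∂ẋ^1, …, ∂/∂ẋ^n` of `ℝⁿ × ℝⁿ`. -/
def tangentFrame (d : ℕ) : Fin (2 * d + 1 + 1) → Model d × Model d := fun i =>
  Fin.append (fun j => (frame d j, (0 : Model d))) (fun j => ((0 : Model d), frame d j))
    (Fin.cast (by omega : 2 * d + 1 + 1 = (d + 1) + (d + 1)) i)

/-- An orientation of `M`, given by a nowhere vanishing smooth `n`-form. -/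
structure IsOrientationForm (o : DForm (𝓡 (d + 1)) M (d + 1)) : Prop where
  smooth : o.SmoothOn univ
  ne_zero : ∀ p : M, o p ≠ 0

variable [T2Space M] [SigmaCompactSpace M]

variable (d M) in
/-- A smooth partition of unity on `M` subordinate to the domains of the preferred charts. -/
theorem exists_chartPartition : ∃ ρ : SmoothPartitionOfUnity M (𝓡 (d + 1)) M univ,
    ρ.IsSubordinate fun c => (chartAt (Model d) c).source :=
  SmoothPartitionOfUnity.exists_isSubordinate (𝓡 (d + 1)) isClosed_univ _
    (fun c => (chartAt (Model d) c).open_source)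
    (fun x _ => mem_iUnion.2 ⟨x, mem_chart_source (Model d) x⟩)

variable (d M) in
/-- A chosen partition of unity subordinate to the charts. -/
def chartPartition : SmoothPartitionOfUnity M (𝓡 (d + 1)) M univ :=
  Classical.choose (exists_chartPartition d M)

/-- The contribution of the chart at `c` to the integrand of an `n`-form on `M` oriented by `o`;
the sign compares the orientation of the chart with that of `M`. -/
def baseIntegrand (o η : DForm (𝓡 (d + 1)) M (d + 1)) (c : M) (x : Model d) : ℝ :=
  chartPartition d M c ((extChartAt (𝓡 (d + 1)) c).symm x) *
    ((SignType.sign (o.inChart c x (frame d)) : ℝ) * η.inChart c x (frame d))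

/-- The integral `∫_M η` of a compactly supported smooth `n`-form on `M` oriented by `o`. -/
def integralM (o η : DForm (𝓡 (d + 1)) M (d + 1)) : ℝ :=
  ∑ᶠ c : M, ∫ x in (extChartAt (𝓡 (d + 1)) c).target, baseIntegrand o η c x

/-- The contribution of the chart of `TM` over the chart at `c` to the integrand of a `2n`-form on
`TM`. The orientation of `TM` is that of `dx^1 ∧ … ∧ dx^n ∧ dẋ^1 ∧ … ∧ dẋ^n`; it is the product of
the orientation of `M` and the induced orientation of the fibres, for either orientation of `M`. -/
def bundleIntegrand (Ω : DForm (𝓡 (d + 1)).tangent (TM d M) (2 * d + 1 + 1)) (c : M)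
    (y : Model d × Model d) : ℝ :=
  chartPartition d M c ((extChartAt (𝓡 (d + 1)).tangent (⟨c, 0⟩ : TM d M)).symm y).proj *
    Ω.inChart (⟨c, 0⟩ : TM d M) y (tangentFrame d)

/-- The `2n`-form `Ω` on `U` is (absolutely) integrable over each chart. -/
def IntegrableU (U : Set (TM d M)) (Ω : DForm (𝓡 (d + 1)).tangent (TM d M) (2 * d + 1 + 1)) :
    Prop :=
  ∀ c : M, IntegrableOn (bundleIntegrand Ω c)
    (chartImage (𝓡 (d + 1)).tangent (⟨c, 0⟩ : TM d M) U)

/-- The integral `∫_U Ω` of a `2n`-form over `U`. -/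
def integralU (U : Set (TM d M)) (Ω : DForm (𝓡 (d + 1)).tangent (TM d M) (2 * d + 1 + 1)) : ℝ :=
  ∑ᶠ c : M, ∫ y in chartImage (𝓡 (d + 1)).tangent (⟨c, 0⟩ : TM d M) U, bundleIntegrand Ω c y

/-- `J = π_ς α`: the smooth `(n-1)`-form `J` on `M` (oriented by `o`) is the integral along the
fibres of `π : U → M` of the `(2n-1)`-form `α` on `U`, i.e. for all compactly supported smooth
`1`-forms `β` on `M` the integral on the left converges and
`∫_U π^*β ∧ α = ∫_M β ∧ J`. -/
structure IsFibreIntegral (o : DForm (𝓡 (d + 1)) M (d + 1)) (U : Set (TM d M))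
    (α : DForm (𝓡 (d + 1)).tangent (TM d M) (2 * d + 1)) (J : DForm (𝓡 (d + 1)) M d) :
    Prop where
  smooth : J.SmoothOn univ
  integrable : ∀ β : DForm (𝓡 (d + 1)) M 1, β.SmoothOn univ →
    (∃ K : Set M, IsCompact K ∧ ∀ p ∉ K, β p = 0) →
    IntegrableU U ((pullbackProj β).wedge α)
  integral_eq : ∀ β : DForm (𝓡 (d + 1)) M 1, β.SmoothOn univ →
    (∃ K : Set M, IsCompact K ∧ ∀ p ∉ K, β p = 0) →
    integralU U ((pullbackProj β).wedge α) = integralM o (β.wedge J)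

end Tangent

end VlasovCurrent

end

/-!
Since `dθ = 0` and `i_R θ = 0` for the radial field `R`, Cartan's formula gives
`L_R θ = d i_R θ + i_R dθ = 0`, so `θ` is invariant under the dilations of the fibres. In fibrewise
polar coordinates `π^*β ∧ χ ∧ θ` is therefore the ray coefficient of `χ` times `dr` times a form
which depends neither on `χ` nor on the radius. Every ray contributes the factor
`∫ rayCoeff χ u r dr = 1`, hence `∫_U π^*β ∧ χ ∧ θ` depends only on `β` and `θ`. Finally a form `J`
of codegree one is determined by the integrals `∫_M β ∧ J`, by the fundamental lemma of the calculus
of variations.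
-/

namespace VlasovCurrent

section LinearAlgebra

variable {V : Type*} [AddCommGroup V] [Module ℝ V] [TopologicalSpace V] {k : ℕ}

theorem wedgeOne_apply (α : V [⋀^Fin 1]→L[ℝ] ℝ) (η : V [⋀^Fin k]→L[ℝ] ℝ) (v : Fin (k + 1) → V) :
    wedgeOne α η v =
      ∑ i : Fin (k + 1), (-1 : ℝ) ^ (i : ℕ) * (α (fun _ => v i) * η (i.removeNth v)) := by
  change AlternatingMap.alternatizeUncurryFin _ v = _
  simp [AlternatingMap.alternatizeUncurryFin_apply]

theorem wedgeOne_compContinuousLinearMap {V' : Type*} [AddCommGroup V'] [Module ℝ V']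
    [TopologicalSpace V'] (α : V [⋀^Fin 1]→L[ℝ] ℝ) (η : V [⋀^Fin k]→L[ℝ] ℝ) (L : V' →L[ℝ] V) :
    (wedgeOne α η).compContinuousLinearMap L =
      wedgeOne (α.compContinuousLinearMap L) (η.compContinuousLinearMap L) := by
  ext v
  simp only [ContinuousAlternatingMap.compContinuousLinearMap_apply, wedgeOne_apply]
  rfl

theorem wedgeOne_zero_right (α : V [⋀^Fin 1]→L[ℝ] ℝ) :
    wedgeOne α (0 : V [⋀^Fin k]→L[ℝ] ℝ) = 0 := by
  ext v
  simp [wedgeOne_apply]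

theorem wedgeOne_zero_left (η : V [⋀^Fin k]→L[ℝ] ℝ) :
    wedgeOne (0 : V [⋀^Fin 1]→L[ℝ] ℝ) η = 0 := by
  ext v
  simp [wedgeOne_apply]

theorem wedgeOne_smul_left (c : ℝ) (α : V [⋀^Fin 1]→L[ℝ] ℝ) (η : V [⋀^Fin k]→L[ℝ] ℝ) :
    wedgeOne (c • α) η = c • wedgeOne α η := by
  ext v
  simp only [wedgeOne_apply, ContinuousAlternatingMap.smul_apply, smul_eq_mul, Finset.mul_sum]
  exact Finset.sum_congr rfl fun i _ => by ring

theorem wedgeOne_smul_right (α : V [⋀^Fin 1]→L[ℝ] ℝ) (c : ℝ) (η : V [⋀^Fin k]→L[ℝ] ℝ) :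
    wedgeOne α (c • η) = c • wedgeOne α η := by
  ext v
  simp only [wedgeOne_apply, ContinuousAlternatingMap.smul_apply, smul_eq_mul, Finset.mul_sum]
  exact Finset.sum_congr rfl fun i _ => by ring

theorem wedgeOne_sub_left (α α' : V [⋀^Fin 1]→L[ℝ] ℝ)
    (η : V [⋀^Fin k]→L[ℝ] ℝ) :
    wedgeOne (α - α') η = wedgeOne α η - wedgeOne α' η := by
  ext v
  simp only [wedgeOne_apply, ContinuousAlternatingMap.sub_apply, ← Finset.sum_sub_distrib]
  exact Finset.sum_congr rfl fun i _ => by ring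

theorem wedgeOne_sub_right (α : V [⋀^Fin 1]→L[ℝ] ℝ)
    (η η' : V [⋀^Fin k]→L[ℝ] ℝ) :
    wedgeOne α (η - η') = wedgeOne α η - wedgeOne α η' := by
  ext v
  simp only [wedgeOne_apply, ContinuousAlternatingMap.sub_apply, ← Finset.sum_sub_distrib]
  exact Finset.sum_congr rfl fun i _ => by ring

theorem InteriorZero.wedgeOne {X : V} {α : V [⋀^Fin 1]→L[ℝ] ℝ} {η : V [⋀^Fin k]→L[ℝ] ℝ}
    (hα : α (fun _ => X) = 0) (hη : InteriorZero X η) : InteriorZero X (wedgeOne α η) := by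
  rintro v ⟨j, rfl⟩
  rw [wedgeOne_apply]
  refine Finset.sum_eq_zero fun i _ => ?_
  obtain rfl | hij := eq_or_ne j i
  · simp [hα]
  · obtain ⟨l, rfl⟩ := Fin.exists_succAbove_eq hij
    simp [hη (i.removeNth v) ⟨l, rfl⟩]

theorem InteriorZero.eq_zero_of_finrank [FiniteDimensional ℝ V] (hk : Module.finrank ℝ V = k)
    {X : V} (hX : X ≠ 0) {η : V [⋀^Fin k]→L[ℝ] ℝ} (h : InteriorZero X η) : η = 0 := by
  have hXi : LinearIndepOn ℝ id {X} := LinearIndepOn.singleton hX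
  let b := Module.Basis.extend hXi
  have : Fintype (hXi.extend (subset_univ _)) := FiniteDimensional.fintypeBasisIndex b
  apply ContinuousAlternatingMap.toAlternatingMap_injective
  refine Module.Basis.ext_alternating b fun v hv => h _ ?_
  have hv' : Function.Bijective v := (Fintype.bijective_iff_injective_and_card v).2
    ⟨hv, by rw [Fintype.card_fin, ← hk, Module.finrank_eq_card_basis b]⟩
  obtain ⟨i, hi⟩ := hv'.2 ⟨X, hXi.subset_extend _ rfl⟩
  exact ⟨i, by simp [hi, b]⟩

theorem wedgeOne_wedgeOne_eq_smul [FiniteDimensional ℝ V]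
    (hk : Module.finrank ℝ V = k + 1 + 1) {X : V} {β χ τ : V [⋀^Fin 1]→L[ℝ] ℝ}
    {θ : V [⋀^Fin k]→L[ℝ] ℝ} (hβ : β (fun _ => X) = 0) (hθ : InteriorZero X θ)
    (hτ : τ (fun _ => X) = 1) :
    wedgeOne β (wedgeOne χ θ) = χ (fun _ => X) • wedgeOne β (wedgeOne τ θ) := by
  have hX : X ≠ 0 := by
    rintro rfl
    exact one_ne_zero (hτ.symm.trans (τ.map_coord_zero 0 rfl))
  have hzero : wedgeOne β (wedgeOne (χ - χ (fun _ => X) • τ) θ) = 0 :=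
    (InteriorZero.wedgeOne hβ (InteriorZero.wedgeOne (by simp [hτ]) hθ)).eq_zero_of_finrank hk hX
  rwa [wedgeOne_sub_left, wedgeOne_smul_left, wedgeOne_sub_right, wedgeOne_smul_right,
    sub_eq_zero] at hzero

end LinearAlgebra

section Cartan

variable {E : Type*} [NormedAddCommGroup E] [NormedSpace ℝ E] {k : ℕ} {S : Set E}
  {T : E → E [⋀^Fin k]→L[ℝ] ℝ} {X : E → E} {y : E}

theorem fderivWithin_apply_update_of_interiorZero (hS : UniqueDiffWithinAt ℝ S y)
    (hT : DifferentiableWithinAt ℝ T S y) (hX : DifferentiableWithinAt ℝ X S y)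
    (hi : ∀ z ∈ S, InteriorZero (X z) (T z)) (hy : y ∈ S) (u : E) (w : Fin k → E) (i : Fin k) :
    fderivWithin ℝ T S y u (Function.update w i (X y)) =
      -T y (Function.update w i (fderivWithin ℝ X S y u)) := by
  have hzero : fderivWithin ℝ (fun z => T z (Function.update w i (X z))) S y = 0 := by
    rw [fderivWithin_congr (f := fun _ => (0 : ℝ)) (fun z hz => hi z hz _ ⟨i, by simp⟩)
      (hi y hy _ ⟨i, by simp⟩), fderivWithin_fun_const]
    rfl
  have hupdate (j : Fin k) : HasFDerivWithinAt (fun z => Function.update w i (X z) j)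
      (if j = i then fderivWithin ℝ X S y else 0) S y := by
    obtain rfl | hj := eq_or_ne j i
    · simpa using hX.hasFDerivWithinAt
    · simpa [hj] using hasFDerivWithinAt_const (w j) y S
  have hleibniz := fderivWithin_continuousAlternatingMap_apply_apply hT
    (fun j => (hupdate j).differentiableWithinAt) hS u
  simp only [hzero, (hupdate _).fderivWithin hS] at hleibniz
  rw [Finset.sum_eq_single i (fun j _ hj => (T y).map_coord_zero j (by simp [hj])) (by simp)]
    at hleibniz
  simp only [if_true, Function.update_idem] at hleibniz
  exact eq_neg_of_add_eq_zero_left hleibniz.symm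

theorem extDerivWithin_apply_cons (u : E) (w : Fin k → E) :
    extDerivWithin T S y (Fin.cons u w) = fderivWithin ℝ T S y u w -
      ∑ i, fderivWithin ℝ T S y (w i) (Function.update w i u) := by
  have hterm (i : Fin k) : (-1 : ℤ) ^ (i.succ : ℕ) • fderivWithin ℝ T S y (w i)
      (i.succ.removeNth (Fin.cons u w : Fin (k + 1) → E)) =
      -fderivWithin ℝ T S y (w i) (Function.update w i u) := by
    cases k with
    | zero => exact i.elim0
    | succ k =>
      have hremove : i.succ.removeNth (Fin.cons u w : Fin (k + 2) → E) =
          Matrix.vecCons u (i.removeNth w) := by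
        ext j : 1
        refine Fin.cases ?_ (fun j => ?_) j <;> simp [Fin.removeNth]
      rw [hremove, ← Fin.insertNth_removeNth, ContinuousAlternatingMap.map_insertNth,
        Fin.val_succ, pow_succ', neg_one_mul, neg_smul]
  rw [extDerivWithin, ContinuousAlternatingMap.alternatizeUncurryFin_apply, Fin.sum_univ_succ,
    sub_eq_add_neg, ← Finset.sum_neg_distrib]
  congr 1
  · simp [Fin.removeNth_zero]
  · exact Finset.sum_congr rfl fun i _ => hterm i

theorem lieDerivWithin_eq_zero (hS : UniqueDiffWithinAt ℝ S y)
    (hT : DifferentiableWithinAt ℝ T S y) (hX : DifferentiableWithinAt ℝ X S y)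
    (hd : extDerivWithin T S y = 0) (hi : ∀ z ∈ S, InteriorZero (X z) (T z)) (hy : y ∈ S)
    (w : Fin k → E) :
    fderivWithin ℝ T S y (X y) w
      + ∑ i, T y (Function.update w i (fderivWithin ℝ X S y (w i))) = 0 := by
  have hcartan := extDerivWithin_apply_cons (T := T) (S := S) (y := y) (X y) w
  simp only [hd, fderivWithin_apply_update_of_interiorZero hS hT hX hi hy] at hcartan
  simpa using hcartan.symm

theorem compContinuousLinearMap_flow_eq {A : E →L[ℝ] E} {φ : ℝ → E →L[ℝ] E}
    (hφ : ∀ t, HasDerivAt φ (A ∘L φ t) t) (hφS : ∀ t, MapsTo (φ t) S S)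
    (hS : UniqueDiffOn ℝ S) (hT : DifferentiableOn ℝ T S)
    (hd : ∀ z ∈ S, extDerivWithin T S z = 0) (hi : ∀ z ∈ S, InteriorZero (A z) (T z))
    (hy : y ∈ S) (s t : ℝ) :
    (T (φ s y)).compContinuousLinearMap (φ s) = (T (φ t y)).compContinuousLinearMap (φ t) := by
  ext v
  have hφz (z : E) (t : ℝ) : HasDerivAt (fun t => φ t z) (A (φ t z)) t := by
    simpa using (hφ t).clm_apply (hasDerivAt_const t z)
  have hderiv (t : ℝ) : HasDerivAt (fun t => T (φ t y) fun i => φ t (v i)) 0 t := by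
    have hTφ : HasFDerivWithinAt (fun t => T (φ t y)) (fderivWithin ℝ T S (φ t y) ∘L
        ContinuousLinearMap.toSpanSingleton ℝ (A (φ t y))) univ t :=
      (hT _ (hφS t hy)).hasFDerivWithinAt.comp t (hφz y t).hasFDerivAt.hasFDerivWithinAt
        fun t _ => hφS t hy
    have hleibniz := (hTφ.hasFDerivAt Filter.univ_mem).continuousAlternatingMap_apply
      fun i => (hφz (v i) t).hasFDerivAt
    refine hleibniz.hasDerivAt.congr_deriv ?_
    have hlie := lieDerivWithin_eq_zero (hS _ (hφS t hy)) (hT _ (hφS t hy))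
      A.differentiableWithinAt (hd _ (hφS t hy)) hi (hφS t hy) fun i => φ t (v i)
    simpa [A.fderivWithin (hS _ (hφS t hy))] using hlie
  exact is_const_of_deriv_eq_zero (fun t => (hderiv t).differentiableAt)
    (fun t => (hderiv t).deriv) s t

end Cartan

section ScaleSnd

variable (E F : Type*) [NormedAddCommGroup E] [NormedSpace ℝ E] [NormedAddCommGroup F]
  [NormedSpace ℝ F]

/-- The scaling `(x, v) ↦ (x, r v)`, the coordinate expression of `scale r`. -/
def scaleSnd (r : ℝ) : (E × F) →L[ℝ] (E × F) :=
  (ContinuousLinearMap.id ℝ E).prodMap (r • ContinuousLinearMap.id ℝ F)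

/-- The Euler vector field `(x, v) ↦ (0, v)`, the coordinate expression of the radial field. -/
def euler : (E × F) →L[ℝ] (E × F) :=
  (0 : E →L[ℝ] E).prodMap (ContinuousLinearMap.id ℝ F)

variable {E F}

@[simp]
theorem scaleSnd_apply (r : ℝ) (y : E × F) : scaleSnd E F r y = (y.1, r • y.2) := rfl

@[simp]
theorem euler_apply (y : E × F) : euler E F y = (0, y.2) := rfl

theorem hasDerivAt_scaleSnd_exp (t : ℝ) : HasDerivAt (fun t => scaleSnd E F (Real.exp t))
    (euler E F ∘L scaleSnd E F (Real.exp t)) t := by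
  have haffine (r : ℝ) : scaleSnd E F r = scaleSnd E F 0 + r • euler E F := by
    ext v <;> simp
  have heuler : euler E F ∘L scaleSnd E F (Real.exp t) = Real.exp t • euler E F := by
    ext v <;> simp
  simp only [haffine (Real.exp _)] at heuler ⊢
  rw [heuler]
  exact ((Real.hasDerivAt_exp t).smul_const (euler E F)).const_add _

theorem compContinuousLinearMap_scaleSnd_eq {k : ℕ} {S : Set (E × F)}
    {T : (E × F) → (E × F) [⋀^Fin k]→L[ℝ] ℝ} (hS : UniqueDiffOn ℝ S)
    (hT : DifferentiableOn ℝ T S) (hd : ∀ y ∈ S, extDerivWithin T S y = 0)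
    (hi : ∀ y ∈ S, InteriorZero (euler E F y) (T y))
    (hcone : ∀ r : ℝ, 0 < r → MapsTo (scaleSnd E F r) S S) {y : E × F} (hy : y ∈ S) {r : ℝ}
    (hr : 0 < r) :
    (T (scaleSnd E F r y)).compContinuousLinearMap (scaleSnd E F r) = T y := by
  have hone : scaleSnd E F 1 = ContinuousLinearMap.id ℝ (E × F) := by ext v <;> simp
  have hflow := compContinuousLinearMap_flow_eq hasDerivAt_scaleSnd_exp
    (fun t => hcone _ (Real.exp_pos t)) hS hT hd hi hy (Real.log r) 0
  rw [Real.exp_log hr, Real.exp_zero, hone] at hflow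
  exact hflow

end ScaleSnd

section RegularDomain

variable {E : Type*} [NormedAddCommGroup E] [NormedSpace ℝ E]

theorem mem_tangentConeAt_of_hasFDerivAt_pos {S : Set E} {f : E → ℝ} {f' : E →L[ℝ] ℝ} {x v : E}
    (hf : HasFDerivAt f f' x) (hx : 0 ≤ f x) (hv : 0 < f' v)
    (hS : ∀ᶠ y in 𝓝 x, 0 ≤ f y → y ∈ S) : v ∈ tangentConeAt ℝ S x := by
  have hline : Filter.Tendsto (fun t : ℝ => x + t • v) (𝓝[>] 0) (𝓝 x) := by
    have hcont : Continuous fun t : ℝ => x + t • v := by fun_prop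
    simpa using (hcont.tendsto 0).mono_left nhdsWithin_le_nhds
  refine mem_tangentConeAt_of_add_smul_mem (l := 𝓝[>] (0 : ℝ)) (c := id)
    (nhdsWithin_mono 0 fun t ht => ne_of_gt ht) ?_
  filter_upwards [(hf.hasLineDerivAt v).tendsto_slope_zero_right.eventually (lt_mem_nhds hv),
    hline.eventually hS, self_mem_nhdsWithin] with t hslope hmem ht
  have hincr : 0 < f (x + t • v) - f x := pos_of_mul_pos_right hslope (inv_pos.2 ht).le
  exact hmem (by linarith)

theorem uniqueDiffWithinAt_of_hasFDerivAt_ne_zero {S : Set E} {f : E → ℝ} {f' : E →L[ℝ] ℝ} {x : E}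
    (hf : HasFDerivAt f f' x) (hx : 0 ≤ f x) (hf' : f' ≠ 0)
    (hS : ∀ᶠ y in 𝓝 x, 0 ≤ f y → y ∈ S) : UniqueDiffWithinAt ℝ S x := by
  refine ⟨?_, subset_closure (hS.self_of_nhds hx)⟩
  have hhalf : {v | 0 < f' v} ⊆ (Submodule.span ℝ (tangentConeAt ℝ S x) : Set E) := fun v hv =>
    Submodule.subset_span (mem_tangentConeAt_of_hasFDerivAt_pos hf hx hv hS)
  have hopen : IsOpen {v | 0 < f' v} := isOpen_lt continuous_const f'.continuous
  obtain ⟨w, hw⟩ : ∃ w, 0 < f' w := by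
    obtain ⟨w, hw⟩ := DFunLike.ne_iff.1 hf'
    rcases lt_or_gt_of_ne hw with h | h
    · exact ⟨-w, by simpa using h⟩
    · exact ⟨w, h⟩
  rw [Submodule.eq_top_of_nonempty_interior' _ ⟨w, interior_maximal hhalf hopen hw⟩]
  exact dense_univ

variable {H : Type*} [TopologicalSpace H] {N : Type*} [TopologicalSpace N] [ChartedSpace H N]

/-- `U` is a domain with regular boundary: near each of its points it is given by `0 ≤ f`, where
`f` is differentiable with non-zero derivative wherever it vanishes. Open sets are included, with
`f = 1`; the boundary points that matter are those belonging to `U`. -/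
def IsRegularDomain (I : ModelWithCorners ℝ E H) (U : Set N) : Prop :=
  ∀ u ∈ U, ∃ V : Set N, IsOpen V ∧ u ∈ V ∧ ∃ f : N → ℝ, MDifferentiableOn I 𝓘(ℝ, ℝ) f V ∧
    U ∩ V = {w ∈ V | 0 ≤ f w} ∧ ∀ w ∈ V, f w = 0 → mfderiv I 𝓘(ℝ, ℝ) f w ≠ 0

variable {I : ModelWithCorners ℝ E H} {U : Set N}

theorem IsRegularDomain.isLocallyClosed (hU : IsRegularDomain I U) : IsLocallyClosed U := by
  refine ((isLocallyClosed_tfae U).out 0 2).2 fun u hu => ?_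
  obtain ⟨V, hV, huV, f, hf, hUV, -⟩ := hU u hu
  refine ⟨V, hV.mem_nhds huV, ?_⟩
  have hpreimage : (Subtype.val : V → N) ⁻¹' U = {w : V | 0 ≤ f w} := by
    ext w
    have hw : (w : N) ∈ U ∩ V ↔ (w : N) ∈ {w ∈ V | 0 ≤ f w} := by rw [hUV]
    simpa using hw
  rw [hpreimage]
  exact isClosed_le continuous_const hf.continuousOn.domRestrict

theorem IsRegularDomain.measurableSet [MeasurableSpace N] [OpensMeasurableSpace N]
    (hU : IsRegularDomain I U) : MeasurableSet U := by
  obtain ⟨O, C, hO, hC, rfl⟩ := hU.isLocallyClosed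
  exact hO.measurableSet.inter hC.measurableSet

theorem IsRegularDomain.uniqueDiffOn {S : Set E} (hS : IsRegularDomain 𝓘(ℝ, E) S) :
    UniqueDiffOn ℝ S := by
  intro x hxS
  obtain ⟨V, hV, hxV, f, hf, hSV, hf'⟩ := hS x hxS
  have hmem (y : E) (hy : y ∈ V) : y ∈ S ↔ 0 ≤ f y := by
    have : y ∈ S ∩ V ↔ y ∈ {w ∈ V | 0 ≤ f w} := by rw [hSV]
    simpa [hy] using this
  have hev : ∀ᶠ y in 𝓝 x, 0 ≤ f y → y ∈ S := by
    filter_upwards [hV.mem_nhds hxV] with y hy using (hmem y hy).2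
  have hfx : DifferentiableAt ℝ f x :=
    (mdifferentiableOn_iff_differentiableOn.1 hf).differentiableAt (hV.mem_nhds hxV)
  obtain h0 | hpos := ((hmem x hxV).1 hxS).eq_or_lt
  · refine uniqueDiffWithinAt_of_hasFDerivAt_ne_zero hfx.hasFDerivAt h0.le ?_ hev
    rw [← mfderiv_eq_fderiv]
    exact hf' x hxV h0.symm
  · refine uniqueDiffWithinAt_of_mem_nhds ?_
    filter_upwards [hev, hfx.continuousAt.eventually (lt_mem_nhds hpos)] with y hy hfy
      using hy hfy.le

end RegularDomain

section Charts

variable {E : Type*} [NormedAddCommGroup E] [NormedSpace ℝ E] {H : Type*} [TopologicalSpace H]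
  {I : ModelWithCorners ℝ E H} [I.Boundaryless] {N : Type*} [TopologicalSpace N]
  [ChartedSpace H N] [IsManifold I 1 N] {c : N} {y : E}

theorem mdifferentiableAt_extChartAt_symm (hy : y ∈ (extChartAt I c).target) :
    MDifferentiableAt 𝓘(ℝ, E) I (extChartAt I c).symm y := by
  have hwithin := mdifferentiableWithinAt_extChartAt_symm (I := I) hy
  rwa [I.range_eq_univ, mdifferentiableWithinAt_univ] at hwithin

theorem mfderiv_extChartAt_comp_mfderiv_symm (hy : y ∈ (extChartAt I c).target) :
    (mfderiv I 𝓘(ℝ, E) (extChartAt I c) ((extChartAt I c).symm y)) ∘L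
      (mfderiv 𝓘(ℝ, E) I (extChartAt I c).symm y) = ContinuousLinearMap.id _ _ := by
  have hwithin := mfderiv_extChartAt_comp_mfderivWithin_extChartAt_symm (I := I) hy
  rwa [I.range_eq_univ, mfderivWithin_univ] at hwithin

theorem mfderiv_symm_comp_mfderiv_extChartAt (hy : y ∈ (extChartAt I c).target) :
    (mfderiv 𝓘(ℝ, E) I (extChartAt I c).symm y) ∘L
      (mfderiv I 𝓘(ℝ, E) (extChartAt I c) ((extChartAt I c).symm y)) =
      ContinuousLinearMap.id _ _ := by
  have hwithin := mfderivWithin_extChartAt_symm_comp_mfderiv_extChartAt (I := I) hy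
  rwa [I.range_eq_univ, mfderivWithin_univ] at hwithin

theorem IsRegularDomain.chartImage {U : Set N} (hU : IsRegularDomain I U) (c : N) :
    IsRegularDomain 𝓘(ℝ, E) (chartImage I c U) := by
  rintro y ⟨hyt, hyU⟩
  obtain ⟨V, hV, hyV, f, hf, hUV, hf'⟩ := hU _ hyU
  refine ⟨(extChartAt I c).target ∩ (extChartAt I c).symm ⁻¹' V,
    (continuousOn_extChartAt_symm c).isOpen_inter_preimage (isOpen_extChartAt_target c) hV,
    ⟨hyt, hyV⟩, f ∘ (extChartAt I c).symm, ?_, ?_, ?_⟩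
  · exact fun z hz => ((hf.mdifferentiableAt (hV.mem_nhds hz.2)).comp z
      (mdifferentiableAt_extChartAt_symm hz.1)).mdifferentiableWithinAt
  · have hiff := Set.ext_iff.1 hUV
    ext z
    have hz := hiff ((extChartAt I c).symm z)
    simp only [VlasovCurrent.chartImage, mem_inter_iff, mem_preimage, mem_ofPred_eq,
      Function.comp_apply] at hz ⊢
    tauto
  · intro z hz hfz h0
    refine hf' _ hz.2 hfz ?_
    rw [mfderiv_comp z (hf.mdifferentiableAt (hV.mem_nhds hz.2))
      (mdifferentiableAt_extChartAt_symm hz.1)] at h0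
    ext v
    have hv := DFunLike.congr_fun (mfderiv_symm_comp_mfderiv_extChartAt hz.1) v
    rw [← ContinuousLinearMap.id_apply (R₁ := ℝ) v, ← hv]
    exact DFunLike.congr_fun h0 _

end Charts

section Polar

variable {E : Type*} [NormedAddCommGroup E] [NormedSpace ℝ E] [FiniteDimensional ℝ E]
  [Nontrivial E] [MeasurableSpace E] [BorelSpace E]

theorem integral_eq_integral_toSphere {F : Type*} [NormedAddCommGroup F] [NormedSpace ℝ F]
    (μ : Measure E) [μ.IsAddHaarMeasure] {f : E → F} (hf : Integrable f μ) :
    ∫ x, f x ∂μ = ∫ w : Metric.sphere (0 : E) 1, (∫ r in Ioi (0 : ℝ),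
      r ^ (Module.finrank ℝ E - 1) • f (r • (w : E))) ∂μ.toSphere := by
  set n := Module.finrank ℝ E - 1
  let g : Metric.sphere (0 : E) 1 × Ioi (0 : ℝ) → F := fun p => f ((p.2 : ℝ) • (p.1 : E))
  have hg (x : ({0}ᶜ : Set E)) : g (homeomorphUnitSphereProd E x) = f x := by
    have hx : ‖(x : E)‖ ≠ 0 := norm_ne_zero_iff.2 x.2
    simp [g, homeomorphUnitSphereProd_apply_fst_coe, homeomorphUnitSphereProd_apply_snd_coe,
      smul_smul, mul_inv_cancel₀ hx]
  have hmp := μ.measurePreserving_homeomorphUnitSphereProd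
  have hemb : MeasurableEmbedding (homeomorphUnitSphereProd E) :=
    (homeomorphUnitSphereProd E).measurableEmbedding
  have hint : Integrable g (μ.toSphere.prod (.volumeIoiPow n)) := by
    rw [← hmp.integrable_comp_emb hemb, show g ∘ homeomorphUnitSphereProd E = f ∘ Subtype.val from
      funext hg, ← integrableOn_iff_comap_subtypeVal (measurableSet_singleton _).compl]
    exact hf.integrableOn
  calc ∫ x, f x ∂μ = ∫ x : ({0}ᶜ : Set E), f x ∂μ.comap Subtype.val := by
        rw [integral_subtype_comap (measurableSet_singleton _).compl f, restrict_compl_singleton]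
    _ = ∫ p, g p ∂(μ.toSphere.prod (.volumeIoiPow n)) := by
        rw [← hmp.integral_comp hemb]
        exact integral_congr_ae (.of_forall fun x => (hg x).symm)
    _ = ∫ w, ∫ r, g (w, r) ∂.volumeIoiPow n ∂μ.toSphere := integral_prod _ hint
    _ = _ := by
        refine integral_congr_ae (.of_forall fun w => ?_)
        simp only [Measure.volumeIoiPow, ENNReal.ofReal]
        rw [integral_withDensity_eq_integral_smul
            (measurable_subtype_coe.pow_const _).real_toNNReal,
          integral_subtype_comap measurableSet_Ioi
            fun r : ℝ => Real.toNNReal (r ^ n) • f (r • (w : E))]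
        refine setIntegral_congr_fun measurableSet_Ioi fun r hr => ?_
        simp only [NNReal.smul_def, Real.coe_toNNReal _ (pow_nonneg (le_of_lt (mem_Ioi.1 hr)) _)]

theorem setIntegral_eq_integral_toSphere {X : Type*} [MeasurableSpace X] (ν : Measure X)
    [SFinite ν] (μ : Measure E) [μ.IsAddHaarMeasure] {S : Set (X × E)} (hS : MeasurableSet S)
    (hcone : ∀ x v, ∀ r : ℝ, 0 < r → ((x, r • v) ∈ S ↔ (x, v) ∈ S))
    {F G : X × E → ℝ} {a : X × E → ℝ → ℝ} (hF : IntegrableOn F S (ν.prod μ))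
    (hFG : ∀ y ∈ S, ‖y.2‖ = 1 → ∀ r : ℝ, 0 < r →
      r ^ (Module.finrank ℝ E - 1) * F (y.1, r • y.2) = a y r * G y)
    (ha : ∀ y ∈ S, ‖y.2‖ = 1 → ∫ r in Ioi (0 : ℝ), a y r = 1) :
    ∫ y in S, F y ∂(ν.prod μ) =
      ∫ x, ∫ w : Metric.sphere (0 : E) 1, S.indicator G (x, (w : E)) ∂μ.toSphere ∂ν := by
  have hint : Integrable (S.indicator F) (ν.prod μ) := (integrable_indicator_iff hS).2 hF
  rw [← integral_indicator hS, integral_prod _ hint]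
  refine integral_congr_ae ?_
  filter_upwards [hint.prod_right_ae] with x hx
  rw [integral_eq_integral_toSphere μ hx]
  refine integral_congr_ae (.of_forall fun w => ?_)
  have hw : ‖(w : E)‖ = 1 := by simp
  by_cases hwS : (x, (w : E)) ∈ S
  · calc ∫ r in Ioi (0 : ℝ), r ^ (Module.finrank ℝ E - 1) • S.indicator F (x, r • (w : E))
        = ∫ r in Ioi (0 : ℝ), a (x, w) r * G (x, w) := by
          refine setIntegral_congr_fun measurableSet_Ioi fun r hr => ?_
          rw [indicator_of_mem ((hcone x w r hr).2 hwS), smul_eq_mul, ← hFG (x, w) hwS hw r hr]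
      _ = S.indicator G (x, w) := by
          rw [integral_mul_const, ha (x, w) hwS hw, indicator_of_mem hwS, one_mul]
  · have hzero (r : ℝ) (hr : 0 < r) : S.indicator F (x, r • (w : E)) = 0 :=
      indicator_of_notMem (fun h => hwS ((hcone x w r hr).1 h)) F
    simp only [indicator_of_notMem hwS]
    rw [setIntegral_congr_fun measurableSet_Ioi fun r hr => by rw [hzero r hr, smul_zero],
      integral_zero]

end Polar

section TangentCharts

variable {d : ℕ} {M : Type*} [TopologicalSpace M] [ChartedSpace (Model d) M]
  [IsManifold (𝓡 (d + 1)) ∞ M] {u₀ u : TM d M} {y : Model d × Model d}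

theorem tangent_extChartAt_target (u₀ : TM d M) :
    (extChartAt (𝓡 (d + 1)).tangent u₀).target =
      (extChartAt (𝓡 (d + 1)) u₀.proj).target ×ˢ univ := by
  rw [FiberBundle.extChartAt_target]
  congr 1
  refine inter_eq_left.2 fun x hx => ?_
  simpa using (extChartAt (𝓡 (d + 1)) u₀.proj).map_target hx

theorem mem_tangent_extChartAt_target :
    y ∈ (extChartAt (𝓡 (d + 1)).tangent u₀).target ↔
      y.1 ∈ (extChartAt (𝓡 (d + 1)) u₀.proj).target := by
  rw [tangent_extChartAt_target]; simp

theorem mem_tangent_extChartAt_source :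
    u ∈ (extChartAt (𝓡 (d + 1)).tangent u₀).source ↔
      u.proj ∈ (extChartAt (𝓡 (d + 1)) u₀.proj).source := by
  rw [extChartAt_source, extChartAt_source, TangentBundle.mem_chart_source_iff]

theorem scale_mem_tangent_extChartAt_source {r : ℝ} :
    scale r u ∈ (extChartAt (𝓡 (d + 1)).tangent u₀).source ↔
      u ∈ (extChartAt (𝓡 (d + 1)).tangent u₀).source := by
  rw [mem_tangent_extChartAt_source, mem_tangent_extChartAt_source, scale]

theorem scaleSnd_mem_tangent_extChartAt_target {r : ℝ} :
    scaleSnd _ _ r y ∈ (extChartAt (𝓡 (d + 1)).tangent u₀).target ↔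
      y ∈ (extChartAt (𝓡 (d + 1)).tangent u₀).target := by
  rw [mem_tangent_extChartAt_target, mem_tangent_extChartAt_target, scaleSnd_apply]

/-- The linear coordinates on the tangent space at `p` given by the chart at `c`. -/
noncomputable abbrev fibreCoord (c p : M) : TangentSpace (𝓡 (d + 1)) p →L[ℝ] Model d :=
  (trivializationAt (Model d) (TangentSpace (𝓡 (d + 1))) c).continuousLinearMapAt ℝ p

theorem tangent_extChartAt_apply (hu : u ∈ (extChartAt (𝓡 (d + 1)).tangent u₀).source) :
    extChartAt (𝓡 (d + 1)).tangent u₀ u =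
      (extChartAt (𝓡 (d + 1)) u₀.proj u.proj, fibreCoord u₀.proj u.proj u.snd) := by
  have hbase : u.proj ∈ (trivializationAt (Model d) (TangentSpace (𝓡 (d + 1))) u₀.proj).baseSet :=
    by simpa using mem_tangent_extChartAt_source.1 hu
  simp only [FiberBundle.extChartAt, PartialEquiv.coe_trans, Function.comp_apply,
    PartialEquiv.prod_coe, PartialEquiv.refl_coe, id]
  exact Prod.ext rfl (Bundle.Trivialization.continuousLinearMapAt_apply_of_mem ℝ _ hbase _).symm

theorem tangent_extChartAt_symm_proj (hy : y ∈ (extChartAt (𝓡 (d + 1)).tangent u₀).target) :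
    ((extChartAt (𝓡 (d + 1)).tangent u₀).symm y).proj =
      (extChartAt (𝓡 (d + 1)) u₀.proj).symm y.1 := by
  have hu := (extChartAt (𝓡 (d + 1)).tangent u₀).map_target hy
  have hfst := congrArg Prod.fst (tangent_extChartAt_apply hu)
  rw [(extChartAt (𝓡 (d + 1)).tangent u₀).right_inv hy] at hfst
  rw [hfst, (extChartAt (𝓡 (d + 1)) u₀.proj).left_inv (mem_tangent_extChartAt_source.1 hu)]

theorem tangent_extChartAt_scale (hu : u ∈ (extChartAt (𝓡 (d + 1)).tangent u₀).source) (r : ℝ) :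
    extChartAt (𝓡 (d + 1)).tangent u₀ (scale r u) =
      scaleSnd _ _ r (extChartAt (𝓡 (d + 1)).tangent u₀ u) := by
  rw [tangent_extChartAt_apply hu,
    tangent_extChartAt_apply (scale_mem_tangent_extChartAt_source.2 hu), scaleSnd_apply]
  exact Prod.ext rfl (map_smul (fibreCoord u₀.proj u.proj) r u.snd)

theorem tangent_extChartAt_symm_scaleSnd
    (hy : y ∈ (extChartAt (𝓡 (d + 1)).tangent u₀).target) (r : ℝ) :
    (extChartAt (𝓡 (d + 1)).tangent u₀).symm (scaleSnd _ _ r y) =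
      scale r ((extChartAt (𝓡 (d + 1)).tangent u₀).symm y) := by
  have hu := (extChartAt (𝓡 (d + 1)).tangent u₀).map_target hy
  refine ((extChartAt (𝓡 (d + 1)).tangent u₀).symm_apply_eq
    (scale_mem_tangent_extChartAt_source.2 hu) (scaleSnd_mem_tangent_extChartAt_target.2 hy)).2 ?_
  rw [tangent_extChartAt_scale hu, (extChartAt (𝓡 (d + 1)).tangent u₀).right_inv hy]

theorem verticalLift_eq_mfderiv_symm (hu : u ∈ (extChartAt (𝓡 (d + 1)).tangent u₀).source)
    (w : TangentSpace (𝓡 (d + 1)) u.proj) :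
    verticalLift u w = mfderiv 𝓘(ℝ, Model d × Model d) (𝓡 (d + 1)).tangent
      (extChartAt (𝓡 (d + 1)).tangent u₀).symm (extChartAt (𝓡 (d + 1)).tangent u₀ u)
      ((0 : Model d), fibreCoord u₀.proj u.proj w) := by
  let A : Model d →L[ℝ] Model d := fibreCoord u₀.proj u.proj
  let x := extChartAt (𝓡 (d + 1)) u₀.proj u.proj
  have hfibre (w : Model d) :
      (⟨u.proj, w⟩ : TM d M) ∈ (extChartAt (𝓡 (d + 1)).tangent u₀).source :=
    mem_tangent_extChartAt_source.2 (mem_tangent_extChartAt_source.1 hu)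
  have hinclusion : (fun w : Model d => (⟨u.proj, w⟩ : TM d M)) =
      (extChartAt (𝓡 (d + 1)).tangent u₀).symm ∘ fun w => (x, A w) := by
    funext w
    exact ((extChartAt (𝓡 (d + 1)).tangent u₀).left_inv (hfibre w)).symm.trans
      (congrArg _ (tangent_extChartAt_apply (hfibre w)))
  have hA : HasFDerivAt (fun w : Model d => (x, A w)) ((0 : Model d →L[ℝ] Model d).prod A) u.snd :=
    (hasFDerivAt_const x _).prodMk A.hasFDerivAt
  have hy : extChartAt (𝓡 (d + 1)).tangent u₀ u = (x, A u.snd) := tangent_extChartAt_apply hu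
  have hsymm : MDifferentiableAt 𝓘(ℝ, Model d × Model d) (𝓡 (d + 1)).tangent
      (extChartAt (𝓡 (d + 1)).tangent u₀).symm (x, A u.snd) :=
    mdifferentiableAt_extChartAt_symm (hy ▸ (extChartAt (𝓡 (d + 1)).tangent u₀).map_source hu)
  rw [hy, verticalLift, hinclusion]
  exact DFunLike.congr_fun
    (HasMFDerivAt.comp (M := Model d) u.snd hsymm.hasMFDerivAt hA.hasMFDerivAt).mfderiv w

theorem radial_eq_mfderiv_symm (hu : u ∈ (extChartAt (𝓡 (d + 1)).tangent u₀).source) :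
    radial u = mfderiv 𝓘(ℝ, Model d × Model d) (𝓡 (d + 1)).tangent
      (extChartAt (𝓡 (d + 1)).tangent u₀).symm (extChartAt (𝓡 (d + 1)).tangent u₀ u)
      (euler _ _ (extChartAt (𝓡 (d + 1)).tangent u₀ u)) := by
  rw [radial, verticalLift_eq_mfderiv_symm hu, tangent_extChartAt_apply hu, euler_apply]

theorem verticalLift_scale_eq_mfderiv_symm
    (hu : u ∈ (extChartAt (𝓡 (d + 1)).tangent u₀).source) (r : ℝ) :
    verticalLift (scale r u) u.snd = mfderiv 𝓘(ℝ, Model d × Model d) (𝓡 (d + 1)).tangent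
      (extChartAt (𝓡 (d + 1)).tangent u₀).symm
      (scaleSnd _ _ r (extChartAt (𝓡 (d + 1)).tangent u₀ u))
      (euler _ _ (extChartAt (𝓡 (d + 1)).tangent u₀ u)) := by
  rw [verticalLift_eq_mfderiv_symm (scale_mem_tangent_extChartAt_source.2 hu) u.snd,
    tangent_extChartAt_scale hu, tangent_extChartAt_apply hu, euler_apply]
  rfl

theorem rayCoeff_symm_eq (χ : DForm (𝓡 (d + 1)).tangent (TM d M) 1)
    (hy : y ∈ (extChartAt (𝓡 (d + 1)).tangent u₀).target) (r : ℝ) :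
    rayCoeff χ ((extChartAt (𝓡 (d + 1)).tangent u₀).symm y) r =
      χ.inChart u₀ (scaleSnd _ _ r y) (fun _ => euler _ _ y) := by
  have hlift := verticalLift_scale_eq_mfderiv_symm
    ((extChartAt (𝓡 (d + 1)).tangent u₀).map_target hy) r
  rw [(extChartAt (𝓡 (d + 1)).tangent u₀).right_inv hy] at hlift
  rw [rayCoeff, hlift, DForm.inChart, ← tangent_extChartAt_symm_scaleSnd hy]
  rfl

theorem mfderiv_proj_comp_mfderiv_symm
    (hy : y ∈ (extChartAt (𝓡 (d + 1)).tangent u₀).target) :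
    (mfderiv (𝓡 (d + 1)).tangent (𝓡 (d + 1)) (fun w : TM d M => w.proj)
      ((extChartAt (𝓡 (d + 1)).tangent u₀).symm y)).comp
      (mfderiv 𝓘(ℝ, Model d × Model d) (𝓡 (d + 1)).tangent
        (extChartAt (𝓡 (d + 1)).tangent u₀).symm y) =
    (mfderiv 𝓘(ℝ, Model d) (𝓡 (d + 1)) (extChartAt (𝓡 (d + 1)) u₀.proj).symm y.1).comp
      (ContinuousLinearMap.fst ℝ (Model d) (Model d)) := by
  have hproj : MDifferentiableAt (𝓡 (d + 1)).tangent (𝓡 (d + 1)) (fun w : TM d M => w.proj)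
      ((extChartAt (𝓡 (d + 1)).tangent u₀).symm y) :=
    (Bundle.contMDiff_proj (n := 1) (TangentSpace (𝓡 (d + 1)))).mdifferentiableAt one_ne_zero
  have hleft := HasMFDerivAt.comp (M := Model d × Model d) y hproj.hasMFDerivAt
    (mdifferentiableAt_extChartAt_symm hy).hasMFDerivAt
  have hfst : HasMFDerivAt 𝓘(ℝ, Model d × Model d) 𝓘(ℝ, Model d)
      (Prod.fst : Model d × Model d → Model d) y (ContinuousLinearMap.fst ℝ (Model d) (Model d)) :=
    hasFDerivAt_fst.hasMFDerivAt
  have hright := HasMFDerivAt.comp (M := Model d × Model d) y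
    (mdifferentiableAt_extChartAt_symm (mem_tangent_extChartAt_target.1 hy)).hasMFDerivAt hfst
  refine hasMFDerivAt_unique hleft (hright.congr_of_eventuallyEq ?_)
  filter_upwards [(isOpen_extChartAt_target u₀).mem_nhds hy] with z hz
    using tangent_extChartAt_symm_proj hz

theorem pullbackProj_inChart {k : ℕ} (β : DForm (𝓡 (d + 1)) M k)
    (hy : y ∈ (extChartAt (𝓡 (d + 1)).tangent u₀).target) :
    (pullbackProj β).inChart u₀ y = (β.inChart u₀.proj y.1).compContinuousLinearMap
      (ContinuousLinearMap.fst ℝ (Model d) (Model d)) := by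
  let L : (Model d × Model d) →L[ℝ] Model d :=
    (mfderiv 𝓘(ℝ, Model d) (𝓡 (d + 1)) (extChartAt (𝓡 (d + 1)) u₀.proj).symm y.1).comp
      (ContinuousLinearMap.fst ℝ (Model d) (Model d))
  let βL (p : M) : (Model d × Model d) [⋀^Fin k]→L[ℝ] ℝ :=
    ContinuousAlternatingMap.compContinuousLinearMap (M := Model d) (β p) L
  calc (pullbackProj β).inChart u₀ y = βL ((extChartAt (𝓡 (d + 1)).tangent u₀).symm y).proj :=
        congrArg (ContinuousAlternatingMap.compContinuousLinearMap
          (β ((extChartAt (𝓡 (d + 1)).tangent u₀).symm y).proj)) (mfderiv_proj_comp_mfderiv_symm hy)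
    _ = βL ((extChartAt (𝓡 (d + 1)) u₀.proj).symm y.1) :=
        congrArg βL (tangent_extChartAt_symm_proj hy)

theorem InteriorZero.inChart_euler {k : ℕ} {θ : DForm (𝓡 (d + 1)).tangent (TM d M) k}
    (hy : y ∈ (extChartAt (𝓡 (d + 1)).tangent u₀).target)
    (h : InteriorZero (radial ((extChartAt (𝓡 (d + 1)).tangent u₀).symm y))
      (θ ((extChartAt (𝓡 (d + 1)).tangent u₀).symm y))) :
    InteriorZero (euler _ _ y) (θ.inChart u₀ y) := by
  rintro v ⟨i, hi⟩
  refine h _ ⟨i, ?_⟩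
  rw [radial_eq_mfderiv_symm ((extChartAt (𝓡 (d + 1)).tangent u₀).map_target hy),
    (extChartAt (𝓡 (d + 1)).tangent u₀).right_inv hy, ← hi]
  rfl

theorem mfderiv_tangent_extChartAt_radial
    (hu : u ∈ (extChartAt (𝓡 (d + 1)).tangent u₀).source) :
    mfderiv (𝓡 (d + 1)).tangent 𝓘(ℝ, Model d × Model d) (extChartAt (𝓡 (d + 1)).tangent u₀) u
      (radial u) = euler _ _ (extChartAt (𝓡 (d + 1)).tangent u₀ u) := by
  have hinv := DFunLike.congr_fun (mfderiv_extChartAt_comp_mfderiv_symm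
    ((extChartAt (𝓡 (d + 1)).tangent u₀).map_source hu))
    (euler (Model d) (Model d) (extChartAt (𝓡 (d + 1)).tangent u₀ u))
  rw [(extChartAt (𝓡 (d + 1)).tangent u₀).left_inv hu] at hinv
  rw [radial_eq_mfderiv_symm hu]
  exact hinv

theorem smoothVectorField_radial (U : Set (TM d M)) : SmoothVectorField (fun u => radial u) U := by
  intro u₀ _
  refine ContMDiffAt.contMDiffWithinAt ((Bundle.contMDiffAt_section _).2 ?_)
  have hsmooth : ContMDiffAt (𝓡 (d + 1)).tangent 𝓘(ℝ, Model d × Model d) ∞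
      (fun u : TM d M => euler (Model d) (Model d) (extChartAt (𝓡 (d + 1)).tangent u₀ u)) u₀ :=
    (euler (Model d) (Model d)).contMDiff.contMDiffAt.comp u₀ contMDiffAt_extChartAt
  refine hsmooth.congr_of_eventuallyEq ?_
  filter_upwards [extChartAt_source_mem_nhds (I := (𝓡 (d + 1)).tangent) u₀] with u hu
  have hu' : u ∈ (chartAt (ModelProd (Model d) (Model d)) u₀).source := by
    rwa [extChartAt_source] at hu
  refine Eq.trans ?_ (mfderiv_tangent_extChartAt_radial hu)
  rw [← TangentBundle.continuousLinearMapAt_trivializationAt hu']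
  exact (Bundle.Trivialization.continuousLinearMapAt_apply_of_mem ℝ _ (by simpa using hu') _).symm

end TangentCharts

section Conic

variable {d : ℕ} {M : Type*} [TopologicalSpace M] [ChartedSpace (Model d) M] {U : Set (TM d M)}

/-- `U` is invariant under multiplication of the fibres by positive scalars. -/
def IsConic (U : Set (TM d M)) : Prop :=
  ∀ u ∈ U, ∀ c : ℝ, 0 < c → scale c u ∈ U

theorem scale_scale (a b : ℝ) (u : TM d M) : scale a (scale b u) = scale (a * b) u :=
  congrArg (fun v => (⟨u.proj, v⟩ : TM d M)) (mul_smul a b u.snd).symm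

theorem scale_one (u : TM d M) : scale 1 u = u := by
  simp [scale]

theorem IsConic.scale_mem_iff (hU : IsConic U) {c : ℝ} (hc : 0 < c) {u : TM d M} :
    scale c u ∈ U ↔ u ∈ U := by
  refine ⟨fun h => ?_, fun h => hU u h c hc⟩
  simpa [scale_scale, inv_mul_cancel₀ hc.ne', scale_one] using hU _ h c⁻¹ (inv_pos.2 hc)

variable [IsManifold (𝓡 (d + 1)) ∞ M]

theorem IsConic.scaleSnd_mem_chartImage_iff (hU : IsConic U) {u₀ : TM d M}
    {y : Model d × Model d} {r : ℝ} (hr : 0 < r) :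
    scaleSnd _ _ r y ∈ chartImage (𝓡 (d + 1)).tangent u₀ U ↔
      y ∈ chartImage (𝓡 (d + 1)).tangent u₀ U := by
  rw [chartImage, mem_inter_iff, mem_inter_iff, scaleSnd_mem_tangent_extChartAt_target,
    mem_preimage, mem_preimage]
  refine and_congr_right fun hy => ?_
  rw [tangent_extChartAt_symm_scaleSnd hy, hU.scale_mem_iff hr]

theorem IsConicSubbundle.isConic (hU : IsConicSubbundle U) : IsConic U :=
  fun u hu c hc => hU.conic u hu c hc.ne'

theorem IsConicSubbundle.isRegularDomain (hU : IsConicSubbundle U) :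
    IsRegularDomain (𝓡 (d + 1)).tangent U := by
  intro u hu
  obtain ⟨V, hV, huV, f, hf, hUV, hf'⟩ := hU.smooth u hu
  refine ⟨V, hV, huV, f, hf.mdifferentiableOn (by simp), hUV, fun w hw hfw h0 => ?_⟩
  obtain ⟨v, hv⟩ := hf' w hw hfw
  exact hv (DFunLike.congr_fun h0 (verticalLift w v))

theorem TransportEquations.interiorZero_radial
    {Ψ : ∀ u : TM d M, ⋀[ℝ]^2 (TangentSpace (𝓡 (d + 1)).tangent u)}
    {θ : DForm (𝓡 (d + 1)).tangent (TM d M) (2 * d)} (hθ : TransportEquations U Ψ θ)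
    (hΨ : IsVlasovBivector U Ψ) (u : TM d M) (hu : u ∈ U) : InteriorZero (radial u) (θ u) := by
  obtain ⟨W, hW, hWΨ⟩ := hΨ
  exact (hθ.null _ _ (smoothVectorField_radial U) hW.smooth hWΨ u hu).1

end Conic

theorem DForm.wedge_inChart {E : Type*} [NormedAddCommGroup E] [NormedSpace ℝ E] {H : Type*}
    [TopologicalSpace H] {I : ModelWithCorners ℝ E H} {N : Type*} [TopologicalSpace N]
    [ChartedSpace H N] {k : ℕ} (α : DForm I N 1) (η : DForm I N k) (c : N) (y : E) :
    (α.wedge η).inChart c y = wedgeOne (α.inChart c y) (η.inChart c y) :=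
  wedgeOne_compContinuousLinearMap _ _ _

section Homogeneity

variable {d : ℕ} {M : Type*} [TopologicalSpace M] [ChartedSpace (Model d) M]
  [IsManifold (𝓡 (d + 1)) ∞ M] {U : Set (TM d M)} {u₀ : TM d M} {y : Model d × Model d} {r : ℝ}

/-- `θ` is a smooth closed form on `U` annihilated by the radial field. By Cartan's formula such a
form is basic for the quotient by positive scalings. -/
structure IsClosedBasic {k : ℕ} (U : Set (TM d M)) (θ : DForm (𝓡 (d + 1)).tangent (TM d M) k) :
    Prop where
  smooth : θ.SmoothOn U
  closed : θ.ClosedOn U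
  interiorZero : ∀ u ∈ U, InteriorZero (radial u) (θ u)

theorem IsClosedBasic.inChart_scaleSnd {k : ℕ} {θ : DForm (𝓡 (d + 1)).tangent (TM d M) k}
    (hθ : IsClosedBasic U θ) (hU : IsRegularDomain (𝓡 (d + 1)).tangent U) (hcone : IsConic U)
    (hy : y ∈ chartImage (𝓡 (d + 1)).tangent u₀ U) (hr : 0 < r) :
    (θ.inChart u₀ (scaleSnd _ _ r y)).compContinuousLinearMap (scaleSnd _ _ r) =
      θ.inChart u₀ y :=
  compContinuousLinearMap_scaleSnd_eq (hU.chartImage u₀).uniqueDiffOn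
    ((hθ.smooth u₀).differentiableOn (by simp)) (hθ.closed u₀)
    (fun _ hz => InteriorZero.inChart_euler hz.1 (hθ.interiorZero _ hz.2))
    (fun _ hs _ hz => (hcone.scaleSnd_mem_chartImage_iff hs).2 hz) hy hr

theorem pullbackProj_inChart_scaleSnd {k : ℕ} (β : DForm (𝓡 (d + 1)) M k)
    (hy : y ∈ (extChartAt (𝓡 (d + 1)).tangent u₀).target) (r : ℝ) :
    ((pullbackProj β).inChart u₀ (scaleSnd _ _ r y)).compContinuousLinearMap (scaleSnd _ _ r) =
      (pullbackProj β).inChart u₀ y := by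
  rw [pullbackProj_inChart β hy,
    pullbackProj_inChart β (scaleSnd_mem_tangent_extChartAt_target.2 hy)]
  rfl

theorem pullbackProj_inChart_euler (β : DForm (𝓡 (d + 1)) M 1)
    (hy : y ∈ (extChartAt (𝓡 (d + 1)).tangent u₀).target) :
    (pullbackProj β).inChart u₀ y (fun _ => euler _ _ y) = 0 := by
  rw [pullbackProj_inChart β hy]
  exact (β.inChart u₀.proj y.1).map_coord_zero 0 rfl

theorem inChart_scaleSnd_euler (χ : DForm (𝓡 (d + 1)).tangent (TM d M) 1)
    (hy : y ∈ (extChartAt (𝓡 (d + 1)).tangent u₀).target) (r : ℝ) :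
    χ.inChart u₀ (scaleSnd _ _ r y) (fun _ => scaleSnd _ _ r (euler _ _ y)) =
      r * rayCoeff χ ((extChartAt (𝓡 (d + 1)).tangent u₀).symm y) r := by
  have hsmul : scaleSnd _ _ r (euler _ _ y) = r • euler _ _ y := by simp
  have hlinear := (χ.inChart u₀ (scaleSnd _ _ r y)).toMultilinearMap.map_smul_univ (fun _ => r)
    fun _ => euler _ _ y
  simp only [Finset.univ_unique, Finset.prod_const, Finset.card_singleton, pow_one] at hlinear
  rw [rayCoeff_symm_eq χ hy, hsmul]
  exact hlinear

/-- The `1`-form `⟨v, dv⟩` on `ℝⁿ × ℝⁿ`, equal to `dr` on the unit sphere bundle. It serves as the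
reference `1`-form dual to the Euler field there. -/
noncomputable def radialForm (y : Model d × Model d) : (Model d × Model d) [⋀^Fin 1]→L[ℝ] ℝ :=
  ContinuousAlternatingMap.ofSubsingleton ℝ _ ℝ (0 : Fin 1)
    ((innerSL ℝ y.2).comp (ContinuousLinearMap.snd ℝ (Model d) (Model d)))

theorem radialForm_euler (hy : ‖y.2‖ = 1) : radialForm y (fun _ => euler _ _ y) = 1 := by
  simp [radialForm, hy]

theorem apply_tangentFrame_scaleSnd (η : (Model d × Model d) [⋀^Fin (2 * d + 1 + 1)]→L[ℝ] ℝ)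
    (r : ℝ) :
    η (fun i => scaleSnd _ _ r (tangentFrame d i)) = r ^ (d + 1) * η (tangentFrame d) := by
  let h : 2 * d + 1 + 1 = (d + 1) + (d + 1) := by omega
  let weight : Fin ((d + 1) + (d + 1)) → ℝ := Fin.append (fun _ => 1) (fun _ => r)
  have hweight (i) :
      scaleSnd _ _ r (tangentFrame d i) = weight (Fin.cast h i) • tangentFrame d i := by
    unfold tangentFrame
    generalize Fin.cast _ i = j
    refine Fin.addCases (fun j => ?_) (fun j => ?_) j
    · simp [weight]
    · simp only [weight, Fin.append_right]
      simp
  have hprod : ∏ i, weight (Fin.cast h i) = r ^ (d + 1) := by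
    refine (Equiv.prod_comp (finCongr h) weight).trans ?_
    rw [Fin.prod_univ_add]
    simp only [weight, Fin.append_left, Fin.append_right]
    simp
  simp only [hweight]
  rw [← hprod]
  exact η.toMultilinearMap.map_smul_univ (fun i => weight (Fin.cast h i)) (tangentFrame d)

variable {θ : DForm (𝓡 (d + 1)).tangent (TM d M) (2 * d)}

/-- The coefficient, at the points of the unit sphere bundle of the chart at `u₀`, of the part of
`π^*β ∧ χ ∧ θ` that does not depend on the support form `χ`. -/
noncomputable def sphereCoeff (β : DForm (𝓡 (d + 1)) M 1)
    (θ : DForm (𝓡 (d + 1)).tangent (TM d M) (2 * d)) (u₀ : TM d M) (y : Model d × Model d) : ℝ :=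
  wedgeOne ((pullbackProj β).inChart u₀ y) (wedgeOne (radialForm y) (θ.inChart u₀ y))
    (tangentFrame d)

theorem wedge_inChart_scaleSnd (hθ : IsClosedBasic U θ)
    (hU : IsRegularDomain (𝓡 (d + 1)).tangent U) (hcone : IsConic U)
    (χ : DForm (𝓡 (d + 1)).tangent (TM d M) 1) (β : DForm (𝓡 (d + 1)) M 1)
    (hy : y ∈ chartImage (𝓡 (d + 1)).tangent u₀ U) (hy1 : ‖y.2‖ = 1) (hr : 0 < r) :
    r ^ d * ((pullbackProj β).wedge (χ.wedge θ)).inChart u₀ (scaleSnd _ _ r y) (tangentFrame d) =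
      rayCoeff χ ((extChartAt (𝓡 (d + 1)).tangent u₀).symm y) r * sphereCoeff β θ u₀ y := by
  set σ := scaleSnd (Model d) (Model d) r
  set Ω := ((pullbackProj β).wedge (χ.wedge θ)).inChart u₀ (σ y)
  have hpullback : Ω.compContinuousLinearMap σ = wedgeOne ((pullbackProj β).inChart u₀ y)
      (wedgeOne ((χ.inChart u₀ (σ y)).compContinuousLinearMap σ) (θ.inChart u₀ y)) := by
    rw [← pullbackProj_inChart_scaleSnd β hy.1 r, ← hθ.inChart_scaleSnd hU hcone hy hr,
      ← wedgeOne_compContinuousLinearMap, ← wedgeOne_compContinuousLinearMap,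
      ← DForm.wedge_inChart, ← DForm.wedge_inChart]
  have hfactor := wedgeOne_wedgeOne_eq_smul (by simp; omega)
    (χ := (χ.inChart u₀ (σ y)).compContinuousLinearMap σ) (pullbackProj_inChart_euler β hy.1)
    (InteriorZero.inChart_euler hy.1 (hθ.interiorZero _ hy.2)) (radialForm_euler hy1)
  have hframe : r ^ (d + 1) * Ω (tangentFrame d) =
      r * rayCoeff χ ((extChartAt (𝓡 (d + 1)).tangent u₀).symm y) r * sphereCoeff β θ u₀ y := by
    rw [← apply_tangentFrame_scaleSnd, ← inChart_scaleSnd_euler χ hy.1]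
    exact DFunLike.congr_fun (hpullback.trans hfactor) (tangentFrame d)
  rw [pow_succ', mul_assoc, mul_assoc] at hframe
  exact mul_left_cancel₀ hr.ne' hframe

end Homogeneity

section Integral

variable {d : ℕ} {M : Type*} [TopologicalSpace M] [ChartedSpace (Model d) M]
  [IsManifold (𝓡 (d + 1)) ∞ M] [T2Space M] [SigmaCompactSpace M] {U : Set (TM d M)}
  {θ : DForm (𝓡 (d + 1)).tangent (TM d M) (2 * d)} {χ χ' : DForm (𝓡 (d + 1)).tangent (TM d M) 1}
  {β : DForm (𝓡 (d + 1)) M 1}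

theorem bundleIntegrand_scaleSnd (hθ : IsClosedBasic U θ)
    (hU : IsRegularDomain (𝓡 (d + 1)).tangent U) (hcone : IsConic U) {c : M}
    {y : Model d × Model d} (hy : y ∈ chartImage (𝓡 (d + 1)).tangent (⟨c, 0⟩ : TM d M) U)
    (hy1 : ‖y.2‖ = 1) {r : ℝ} (hr : 0 < r) :
    r ^ d * bundleIntegrand ((pullbackProj β).wedge (χ.wedge θ)) c (scaleSnd _ _ r y) =
      rayCoeff χ ((extChartAt (𝓡 (d + 1)).tangent (⟨c, 0⟩ : TM d M)).symm y) r *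
        (chartPartition d M c ((extChartAt (𝓡 (d + 1)) c).symm y.1) *
          sphereCoeff β θ ⟨c, 0⟩ y) := by
  rw [bundleIntegrand, tangent_extChartAt_symm_scaleSnd hy.1, scale,
    tangent_extChartAt_symm_proj hy.1, mul_left_comm,
    wedge_inChart_scaleSnd hθ hU hcone χ β hy hy1 hr, mul_left_comm]

theorem setIntegral_bundleIntegrand_eq (hθ : IsClosedBasic U θ)
    (hU : IsRegularDomain (𝓡 (d + 1)).tangent U) (hcone : IsConic U)
    (hχ : ∀ u ∈ U, ∫ r in Ioi (0 : ℝ), rayCoeff χ u r = 1)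
    (hint : IntegrableU U ((pullbackProj β).wedge (χ.wedge θ))) (c : M) :
    ∫ y in chartImage (𝓡 (d + 1)).tangent (⟨c, 0⟩ : TM d M) U,
        bundleIntegrand ((pullbackProj β).wedge (χ.wedge θ)) c y =
      ∫ x : Model d, ∫ w : Metric.sphere (0 : Model d) 1,
        (chartImage (𝓡 (d + 1)).tangent (⟨c, 0⟩ : TM d M) U).indicator
          (fun y => chartPartition d M c ((extChartAt (𝓡 (d + 1)) c).symm y.1) *
            sphereCoeff β θ ⟨c, 0⟩ y) (x, (w : Model d)) ∂(volume : Measure (Model d)).toSphere :=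
  setIntegral_eq_integral_toSphere volume volume (hU.chartImage _).measurableSet
    (fun x v _ hr => hcone.scaleSnd_mem_chartImage_iff (y := (x, v)) hr) (hint c)
    (fun y hy hy1 r hr => by
      rw [finrank_euclideanSpace_fin, Nat.add_sub_cancel]
      exact bundleIntegrand_scaleSnd hθ hU hcone hy hy1 hr)
    (fun _ hy _ => hχ _ hy.2)

theorem integralU_wedge_eq (hθ : IsClosedBasic U θ)
    (hU : IsRegularDomain (𝓡 (d + 1)).tangent U) (hcone : IsConic U)
    (hχ : ∀ u ∈ U, ∫ r in Ioi (0 : ℝ), rayCoeff χ u r = 1)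
    (hχ' : ∀ u ∈ U, ∫ r in Ioi (0 : ℝ), rayCoeff χ' u r = 1)
    (hint : IntegrableU U ((pullbackProj β).wedge (χ.wedge θ)))
    (hint' : IntegrableU U ((pullbackProj β).wedge (χ'.wedge θ))) :
    integralU U ((pullbackProj β).wedge (χ.wedge θ)) =
      integralU U ((pullbackProj β).wedge (χ'.wedge θ)) :=
  finsum_congr fun c => (setIntegral_bundleIntegrand_eq hθ hU hcone hχ hint c).trans
    (setIntegral_bundleIntegrand_eq hθ hU hcone hχ' hint' c).symm

end Integral

section FormsOnManifolds

variable {E : Type*} [NormedAddCommGroup E] [NormedSpace ℝ E] {H : Type*} [TopologicalSpace H]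
  {I : ModelWithCorners ℝ E H} {N : Type*} [TopologicalSpace N] [ChartedSpace H N] {k : ℕ}
  {U : Set N} {c : N} {y : E}

/-- `η` is a continuous form on `U`: the coefficients of its coordinate expressions are
continuous. -/
def DForm.IsContinuousOn (η : DForm I N k) (U : Set N) : Prop :=
  ∀ (c : N) (v : Fin k → E), ContinuousOn (fun y => η.inChart c y v) (chartImage I c U)

/-- `η` vanishes outside a compact set. -/
def DForm.IsCompactlySupported (η : DForm I N k) : Prop :=
  ∃ K : Set N, IsCompact K ∧ ∀ p ∉ K, η p = 0

theorem chartImage_univ (c : N) : chartImage I c univ = (extChartAt I c).target := by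
  simp [chartImage]

theorem DForm.inChart_eq_zero {η : DForm I N k} (h : η ((extChartAt I c).symm y) = 0) :
    η.inChart c y = 0 := by
  rw [DForm.inChart, h]
  rfl

theorem DForm.SmoothOn.isContinuousOn {η : DForm I N k} (h : η.SmoothOn U) :
    η.IsContinuousOn U := fun c v =>
  (ContinuousAlternatingMap.apply ℝ E ℝ v).continuous.comp_continuousOn (h c).continuousOn

theorem DForm.IsContinuousOn.wedge {α : DForm I N 1} {η : DForm I N k} (hα : α.IsContinuousOn U)
    (hη : η.IsContinuousOn U) : (α.wedge η).IsContinuousOn U := by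
  intro c v
  simp only [DForm.wedge_inChart, wedgeOne_apply]
  exact continuousOn_finsetSum _ fun i _ => continuousOn_const.mul ((hα c _).mul (hη c _))

theorem DForm.IsCompactlySupported.wedge_left {α : DForm I N 1} (hα : α.IsCompactlySupported)
    (η : DForm I N k) : (α.wedge η).IsCompactlySupported := by
  obtain ⟨K, hK, hαK⟩ := hα
  exact ⟨K, hK, fun p hp => by rw [DForm.wedge, hαK p hp, wedgeOne_zero_left]⟩

theorem DForm.IsContinuousOn.smul {f : N → ℝ} (hf : Continuous f) {η : DForm I N k}
    (hη : η.IsContinuousOn U) :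
    DForm.IsContinuousOn (I := I) (fun p => f p • η p) U := fun c v =>
  (hf.comp_continuousOn ((continuousOn_extChartAt_symm c).mono inter_subset_left)).mul (hη c v)

theorem DForm.isCompactlySupported_smul {f : N → ℝ} (hf : HasCompactSupport f)
    (η : DForm I N k) : DForm.IsCompactlySupported (I := I) fun p => f p • η p :=
  ⟨tsupport f, hf, fun p hp => by
    simp only [image_eq_zero_of_notMem_tsupport hp]
    exact zero_smul ℝ _⟩

theorem DForm.IsContinuousOn.sub {η η' : DForm I N k}
    (hη : η.IsContinuousOn U) (hη' : η'.IsContinuousOn U) :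
    DForm.IsContinuousOn (I := I) (η - η') U := fun c v =>
  (hη c v).sub (hη' c v)

theorem integrableOn_chartImage [MeasurableSpace E] [OpensMeasurableSpace E] {μ : Measure E}
    [IsFiniteMeasureOnCompacts μ] [T2Space E] (hS : MeasurableSet (chartImage I c U)) {f : E → ℝ}
    (hf : ContinuousOn f (chartImage I c U)) {K : Set N} (hK : IsCompact K)
    (hKU : K ⊆ (extChartAt I c).source ∩ U)
    (hfK : ∀ y ∈ chartImage I c U, f y ≠ 0 → (extChartAt I c).symm y ∈ K) :
    IntegrableOn f (chartImage I c U) μ := by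
  have hK' : IsCompact (extChartAt I c '' K) := hK.image_of_continuousOn
    ((continuousOn_extChartAt c).mono (hKU.trans inter_subset_left))
  have hsub : extChartAt I c '' K ⊆ chartImage I c U := by
    rintro _ ⟨p, hp, rfl⟩
    refine ⟨(extChartAt I c).map_source (hKU hp).1, ?_⟩
    rw [mem_preimage, (extChartAt I c).left_inv (hKU hp).1]
    exact (hKU hp).2
  refine ((hf.mono hsub).integrableOn_compact hK').of_forall_sdiff_eq_zero hS ?_
  rintro y ⟨hy, hyK⟩
  by_contra hne
  exact hyK ⟨_, hfK y hy hne, (extChartAt I c).right_inv hy.1⟩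

end FormsOnManifolds

section VerticalSupport

variable {d : ℕ} {M : Type*} [TopologicalSpace M] [ChartedSpace (Model d) M]
  [IsManifold (𝓡 (d + 1)) ∞ M] {U : Set (TM d M)}

theorem DForm.IsContinuousOn.pullbackProj {k : ℕ} {β : DForm (𝓡 (d + 1)) M k}
    (hβ : β.IsContinuousOn univ) : (pullbackProj β).IsContinuousOn U := by
  intro u₀ v
  have hcomp : ContinuousOn
      (fun y : Model d × Model d => β.inChart u₀.proj y.1 fun i => (v i).1)
      (chartImage (𝓡 (d + 1)).tangent u₀ U) :=
    (hβ u₀.proj _).comp continuousOn_fst fun y hy => by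
      rw [chartImage_univ]
      exact mem_tangent_extChartAt_target.1 hy.1
  refine hcomp.congr fun y hy => ?_
  simp only [pullbackProj_inChart β hy.1]
  rfl

theorem pullbackProj_wedge_ne_zero {k : ℕ} {β : DForm (𝓡 (d + 1)) M 1}
    {α : DForm (𝓡 (d + 1)).tangent (TM d M) k} {u : TM d M}
    (h : ((pullbackProj β).wedge α) u ≠ 0) : β u.proj ≠ 0 ∧ α u ≠ 0 := by
  refine ⟨fun hβ => h ?_, fun hα => h ?_⟩
  · have hpullback : pullbackProj β u = 0 := by
      rw [pullbackProj, hβ]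
      rfl
    rw [DForm.wedge, hpullback, wedgeOne_zero_left]
  · rw [DForm.wedge, hα, wedgeOne_zero_right]

variable [T2Space M] [SigmaCompactSpace M]

theorem tsupport_chartPartition_subset (c : M) :
    tsupport (chartPartition d M c) ⊆ (extChartAt (𝓡 (d + 1)) c).source := by
  rw [extChartAt_source]
  exact Classical.choose_spec (exists_chartPartition d M) c

theorem continuousOn_bundleIntegrand {Ω : DForm (𝓡 (d + 1)).tangent (TM d M) (2 * d + 1 + 1)}
    (hΩ : Ω.IsContinuousOn U) (c : M) :
    ContinuousOn (bundleIntegrand Ω c) (chartImage (𝓡 (d + 1)).tangent (⟨c, 0⟩ : TM d M) U) := by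
  have hproj : Continuous (fun u : TM d M => u.proj) :=
    FiberBundle.continuous_proj (Model d) (TangentSpace (𝓡 (d + 1)))
  refine ContinuousOn.mul ?_ (hΩ _ _)
  exact ((chartPartition d M c).contMDiff.continuous.comp hproj).comp_continuousOn
    ((continuousOn_extChartAt_symm _).mono inter_subset_left)

theorem VerticalCompactSupport.integrableU (hU : IsRegularDomain (𝓡 (d + 1)).tangent U)
    {α : DForm (𝓡 (d + 1)).tangent (TM d M) (2 * d + 1)} (hα : α.IsContinuousOn U)
    (h : VerticalCompactSupport U α) {β : DForm (𝓡 (d + 1)) M 1} (hβ : β.IsContinuousOn univ)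
    (hβc : β.IsCompactlySupported) : IntegrableU U ((pullbackProj β).wedge α) := by
  intro c
  obtain ⟨K₀, hK₀, hβK₀⟩ := hβc
  have hC : IsCompact (K₀ ∩ tsupport (chartPartition d M c)) :=
    hK₀.inter_right (isClosed_tsupport _)
  obtain ⟨K, hK, hKU, hαK⟩ := h _ hC
  have hproj : Continuous (fun u : TM d M => u.proj) :=
    FiberBundle.continuous_proj (Model d) (TangentSpace (𝓡 (d + 1)))
  refine integrableOn_chartImage (hU.chartImage _).measurableSet
    (continuousOn_bundleIntegrand (hβ.pullbackProj.wedge hα) c)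
    (hK.inter_right (hC.isClosed.preimage hproj)) ?_ ?_
  · exact fun u hu => ⟨mem_tangent_extChartAt_source.2 (tsupport_chartPartition_subset c hu.2.2),
      hKU hu.1⟩
  · intro y hy hne
    obtain ⟨hρ, hΩ⟩ := mul_ne_zero_iff.1 hne
    obtain ⟨hβy, hαy⟩ := pullbackProj_wedge_ne_zero fun h0 => hΩ <| by
      rw [DForm.inChart_eq_zero h0]
      rfl
    have hyC : ((extChartAt (𝓡 (d + 1)).tangent (⟨c, 0⟩ : TM d M)).symm y).proj ∈
        K₀ ∩ tsupport (chartPartition d M c) :=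
      ⟨by_contra fun h0 => hβy (hβK₀ _ h0), subset_tsupport _ hρ⟩
    exact ⟨hαK _ hy.2 hyC hαy, hyC⟩

end VerticalSupport

theorem exists_wedgeOne_ne_zero {V : Type*} [AddCommGroup V] [Module ℝ V] [TopologicalSpace V]
    [IsTopologicalAddGroup V] [ContinuousSMul ℝ V] [T2Space V] [FiniteDimensional ℝ V] {k : ℕ}
    (hk : k < Module.finrank ℝ V) {η : V [⋀^Fin k]→L[ℝ] ℝ} (hη : η ≠ 0) :
    ∃ α : V [⋀^Fin 1]→L[ℝ] ℝ, wedgeOne α η ≠ 0 := by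
  obtain ⟨v, hv⟩ := DFunLike.ne_iff.1 hη
  have hspan : Submodule.span ℝ (range v) < ⊤ := by
    refine lt_top_iff_ne_top.2 fun htop => hk.not_ge ?_
    have hcard := finrank_range_le_card (R := ℝ) v
    rwa [Set.finrank, htop, finrank_top, Fintype.card_fin] at hcard
  obtain ⟨l, hl, hlspan⟩ := Submodule.exists_le_ker_of_lt_top _ hspan
  obtain ⟨w, hw⟩ := DFunLike.ne_iff.1 hl
  refine ⟨ContinuousAlternatingMap.ofSubsingleton ℝ V ℝ 0 l.toContinuousLinearMap, fun h => ?_⟩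
  have hlv : ∀ i, l (v i) = 0 := fun i => hlspan (Submodule.subset_span ⟨i, rfl⟩)
  have heval : wedgeOne (ContinuousAlternatingMap.ofSubsingleton ℝ V ℝ 0 l.toContinuousLinearMap) η
      (Fin.cons w v) = l w * η v := by
    have hremove : (0 : Fin (k + 1)).removeNth (Fin.cons w v : Fin (k + 1) → V) = v := by
      rw [Fin.removeNth_zero, Fin.tail_cons]
    simp [wedgeOne_apply, Fin.sum_univ_succ, hlv, hremove]
  rw [h] at heval
  exact mul_ne_zero hw hv heval.symm

section Differential

variable {E : Type*} [NormedAddCommGroup E] [NormedSpace ℝ E] {H : Type*} [TopologicalSpace H]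
  {I : ModelWithCorners ℝ E H} {N : Type*} [TopologicalSpace N] [ChartedSpace H N]

variable (I) in
/-- The differential of a function, as a `1`-form. -/
noncomputable def differential (g : N → ℝ) : DForm I N 1 := fun p =>
  ContinuousAlternatingMap.ofSubsingleton ℝ _ ℝ (0 : Fin 1)
    (mfderiv I 𝓘(ℝ, ℝ) g p : TangentSpace I p →L[ℝ] ℝ)

variable [IsManifold I ∞ N]

theorem contDiffOn_comp_extChartAt_symm {g : N → ℝ}
    (hg : ContMDiff I 𝓘(ℝ, ℝ) ∞ g) (c : N) :
    ContDiffOn ℝ ∞ (g ∘ (extChartAt I c).symm) (extChartAt I c).target :=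
  (hg.comp_contMDiffOn (contMDiffOn_extChartAt_symm c)).contDiffOn

theorem DForm.SmoothOn.smul {k : ℕ} {f : N → ℝ} (hf : ContMDiff I 𝓘(ℝ, ℝ) ∞ f)
    {η : DForm I N k} {U : Set N} (hη : η.SmoothOn U) :
    DForm.SmoothOn (I := I) (fun p => f p • η p) U := fun c =>
  ((contDiffOn_comp_extChartAt_symm hf c).mono inter_subset_left).smul (hη c)

theorem differential_inChart [I.Boundaryless] {g : N → ℝ} (hg : MDifferentiable I 𝓘(ℝ, ℝ) g)
    {c : N} {x : E} (hx : x ∈ (extChartAt I c).target) :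
    (differential I g).inChart c x = ContinuousAlternatingMap.ofSubsingleton ℝ E ℝ (0 : Fin 1)
      (fderiv ℝ (g ∘ (extChartAt I c).symm) x) := by
  have : IsManifold I 1 N := IsManifold.of_le (n := ∞) (by simp)
  have hcomp := HasMFDerivAt.comp (M := E) x (hg ((extChartAt I c).symm x)).hasMFDerivAt
    (mdifferentiableAt_extChartAt_symm hx).hasMFDerivAt
  rw [← mfderiv_eq_fderiv, hcomp.mfderiv]
  rfl

theorem smoothOn_differential [I.Boundaryless] {g : N → ℝ} (hg : ContMDiff I 𝓘(ℝ, ℝ) ∞ g) :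
    (differential I g).SmoothOn univ := by
  intro c
  rw [chartImage_univ]
  have hfderiv := (contDiffOn_comp_extChartAt_symm hg c).fderiv_of_isOpen (m := ∞)
    (isOpen_extChartAt_target c) (by simp)
  exact ((ContinuousAlternatingMap.ofSubsingletonLIE (𝕜 := ℝ) (E := E) (F := ℝ)
    (0 : Fin 1)).contDiff.comp_contDiffOn hfderiv).congr
      fun x hx => differential_inChart (hg.mdifferentiable (by simp)) hx

theorem exists_differential_eq [FiniteDimensional ℝ E] [T2Space N] (p : N)
    (α : TangentSpace I p [⋀^Fin 1]→L[ℝ] ℝ) :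
    ∃ g : N → ℝ, ContMDiff I 𝓘(ℝ, ℝ) ∞ g ∧ differential I g p = α := by
  have : IsManifold I 1 N := IsManifold.of_le (n := ∞) (by simp)
  obtain ⟨b⟩ : Nonempty (SmoothBumpFunction I p) := inferInstance
  let l : E →L[ℝ] ℝ := (ContinuousAlternatingMap.ofSubsingleton ℝ E ℝ (0 : Fin 1)).symm α
  have hl : ContMDiffOn I 𝓘(ℝ, ℝ) ∞ (fun q => l (extChartAt I p q)) (chartAt H p).source :=
    l.contMDiff.comp_contMDiffOn contMDiffOn_extChartAt
  have heq : (fun q => b q • l (extChartAt I p q)) =ᶠ[𝓝 p] fun q => l (extChartAt I p q) := by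
    filter_upwards [b.eventuallyEq_one] with q hq
    simp [hq]
  have hderiv : HasMFDerivAt I 𝓘(ℝ, ℝ) (fun q => l (extChartAt I p q)) p
      (l.comp (mfderiv I 𝓘(ℝ, E) (extChartAt I p) p)) :=
    HasMFDerivAt.comp p l.hasFDerivAt.hasMFDerivAt
      (mdifferentiableAt_extChartAt (mem_chart_source _ p)).hasMFDerivAt
  have hmfderiv := (hderiv.congr_of_eventuallyEq heq).mfderiv
  rw [mfderiv_extChartAt_self] at hmfderiv
  refine ⟨_, b.contMDiff_smul hl, ?_⟩
  refine (congrArg (ContinuousAlternatingMap.ofSubsingleton ℝ E ℝ (0 : Fin 1)) hmfderiv).trans ?_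
  exact (ContinuousAlternatingMap.ofSubsingleton ℝ E ℝ (0 : Fin 1)).apply_symm_apply α

end Differential

section Density

variable {d : ℕ} {M : Type*} [TopologicalSpace M] [ChartedSpace (Model d) M]
  {o η : DForm (𝓡 (d + 1)) M (d + 1)}

theorem eq_zero_of_apply_frame {f : Model d [⋀^Fin (d + 1)]→L[ℝ] ℝ} (h : f (frame d) = 0) :
    f = 0 := by
  have hframe : frame d = (EuclideanSpace.basisFun (Fin (d + 1)) ℝ).toBasis := by
    funext i
    simp [frame]
  rw [hframe] at h
  exact ContinuousAlternatingMap.toAlternatingMap_injective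
    ((AlternatingMap.map_basis_eq_zero_iff _ f.toAlternatingMap).1 h)

/-- The density of a top-degree form `η` with respect to a nowhere vanishing one `o`, i.e. the
function `t` with `η = t o`. -/
noncomputable def density (o η : DForm (𝓡 (d + 1)) M (d + 1)) (p : M) : ℝ :=
  (η p : Model d [⋀^Fin (d + 1)]→L[ℝ] ℝ) (frame d) /
    (o p : Model d [⋀^Fin (d + 1)]→L[ℝ] ℝ) (frame d)

theorem density_smul_eq {p : M} (ho : o p ≠ 0) : η p = density o η p • o p := by
  have hframe : (o p : Model d [⋀^Fin (d + 1)]→L[ℝ] ℝ) (frame d) ≠ 0 := fun h =>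
    ho (eq_zero_of_apply_frame h)
  refine sub_eq_zero.1 (eq_zero_of_apply_frame (d := d) ?_)
  exact sub_eq_zero.2 (div_mul_cancel₀ _ hframe).symm

theorem inChart_apply_eq_density_mul {c : M} {x : Model d}
    (ho : o ((extChartAt (𝓡 (d + 1)) c).symm x) ≠ 0) (v : Fin (d + 1) → Model d) :
    η.inChart c x v = density o η ((extChartAt (𝓡 (d + 1)) c).symm x) * o.inChart c x v :=
  DFunLike.congr_fun (density_smul_eq ho) _

theorem density_smul (f : M → ℝ) (p : M) :
    density o (fun p => f p • η p) p = f p * density o η p :=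
  mul_div_assoc _ _ _

variable [IsManifold (𝓡 (d + 1)) ∞ M]

theorem inChart_frame_ne_zero {c : M} {x : Model d}
    (hx : x ∈ (extChartAt (𝓡 (d + 1)) c).target)
    (ho : o ((extChartAt (𝓡 (d + 1)) c).symm x) ≠ 0) : o.inChart c x (frame d) ≠ 0 := by
  have : IsManifold (𝓡 (d + 1)) 1 M := IsManifold.of_le (n := ∞) (by simp)
  intro h
  refine ho (ContinuousAlternatingMap.ext fun v => ?_)
  have hzero := DFunLike.congr_fun (eq_zero_of_apply_frame h) fun i =>
    mfderiv (𝓡 (d + 1)) 𝓘(ℝ, Model d) (extChartAt (𝓡 (d + 1)) c)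
      ((extChartAt (𝓡 (d + 1)) c).symm x) (v i)
  exact Eq.trans (congrArg _ (funext fun i =>
    (DFunLike.congr_fun (mfderiv_symm_comp_mfderiv_extChartAt hx) (v i)).symm)) hzero

theorem continuous_density (ho : IsOrientationForm o) (hη : η.IsContinuousOn univ) :
    Continuous (density o η) := by
  refine continuous_iff_continuousAt.2 fun p => ?_
  have htarget := extChartAt_target_mem_nhds (I := 𝓡 (d + 1)) p
  have hcont : ∀ {ξ : DForm (𝓡 (d + 1)) M (d + 1)}, ξ.IsContinuousOn univ →
      ContinuousAt (fun q => ξ.inChart p (extChartAt (𝓡 (d + 1)) p q) (frame d)) p := by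
    intro ξ hξ
    have hξp := hξ p (frame d)
    rw [chartImage_univ] at hξp
    exact (hξp.continuousAt htarget).comp (continuousAt_extChartAt p)
  have hne : ∀ q ∈ (extChartAt (𝓡 (d + 1)) p).source,
      o.inChart p (extChartAt (𝓡 (d + 1)) p q) (frame d) ≠ 0 := fun q hq =>
    inChart_frame_ne_zero ((extChartAt (𝓡 (d + 1)) p).map_source hq) (ho.ne_zero _)
  refine ((hcont hη).div (hcont ho.smooth.isContinuousOn)
    (hne p (mem_extChartAt_source p))).congr ?_
  filter_upwards [extChartAt_source_mem_nhds (I := 𝓡 (d + 1)) p] with q hq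
  refine (div_eq_iff (hne q hq)).2 ?_
  refine (inChart_apply_eq_density_mul (ho.ne_zero _) _).trans ?_
  rw [(extChartAt (𝓡 (d + 1)) p).left_inv hq]

end Density

section BaseIntegral

variable {d : ℕ} {M : Type*} [TopologicalSpace M] [ChartedSpace (Model d) M]
  [IsManifold (𝓡 (d + 1)) ∞ M] [T2Space M] [SigmaCompactSpace M]
  {o η η' : DForm (𝓡 (d + 1)) M (d + 1)}

theorem baseIntegrand_eq_density_mul_abs {c : M} {x : Model d}
    (ho : o ((extChartAt (𝓡 (d + 1)) c).symm x) ≠ 0) :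
    baseIntegrand o η c x = chartPartition d M c ((extChartAt (𝓡 (d + 1)) c).symm x) *
      (density o η ((extChartAt (𝓡 (d + 1)) c).symm x) * |o.inChart c x (frame d)|) := by
  rw [baseIntegrand, inChart_apply_eq_density_mul (η := η) ho, ← sign_mul_self]
  ring

theorem continuousOn_baseIntegrand (ho : IsOrientationForm o) (hη : η.IsContinuousOn univ)
    (c : M) : ContinuousOn (baseIntegrand o η c) (extChartAt (𝓡 (d + 1)) c).target := by
  have hsymm := continuousOn_extChartAt_symm (I := 𝓡 (d + 1)) c
  have hframe := ho.smooth.isContinuousOn c (frame d)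
  rw [chartImage_univ] at hframe
  refine ContinuousOn.congr ?_ fun x _ => baseIntegrand_eq_density_mul_abs (ho.ne_zero _)
  exact ((chartPartition d M c).contMDiff.continuous.comp_continuousOn hsymm).mul
    (((continuous_density ho hη).comp_continuousOn hsymm).mul hframe.abs)

theorem apply_ne_zero_of_baseIntegrand_ne_zero {c : M} {x : Model d}
    (h : baseIntegrand o η c x ≠ 0) :
    (extChartAt (𝓡 (d + 1)) c).symm x ∈ Function.support (chartPartition d M c) ∧
      η ((extChartAt (𝓡 (d + 1)) c).symm x) ≠ 0 := by
  obtain ⟨hρ, hη⟩ := mul_ne_zero_iff.1 h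
  refine ⟨hρ, fun h0 => (mul_ne_zero_iff.1 hη).2 ?_⟩
  rw [DForm.inChart_eq_zero h0]
  rfl

theorem integrableOn_baseIntegrand (ho : IsOrientationForm o) (hη : η.IsContinuousOn univ)
    (hηc : η.IsCompactlySupported) (c : M) :
    IntegrableOn (baseIntegrand o η c) (extChartAt (𝓡 (d + 1)) c).target := by
  obtain ⟨K, hK, hηK⟩ := hηc
  rw [← chartImage_univ]
  refine integrableOn_chartImage ?_ ?_ (hK.inter_right (isClosed_tsupport (chartPartition d M c)))
    ?_ fun x _ hx => ?_
  · rw [chartImage_univ]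
    exact (isOpen_extChartAt_target c).measurableSet
  · rw [chartImage_univ]
    exact continuousOn_baseIntegrand ho hη c
  · exact fun p hp => ⟨tsupport_chartPartition_subset c hp.2, mem_univ p⟩
  · obtain ⟨hρ, hηx⟩ := apply_ne_zero_of_baseIntegrand_ne_zero hx
    exact ⟨by_contra fun h => hηx (hηK _ h), subset_tsupport _ hρ⟩

theorem finite_support_integral_baseIntegrand (o : DForm (𝓡 (d + 1)) M (d + 1))
    (hηc : η.IsCompactlySupported) :
    (Function.support fun c : M =>
      ∫ x in (extChartAt (𝓡 (d + 1)) c).target, baseIntegrand o η c x).Finite := by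
  obtain ⟨K, hK, hηK⟩ := hηc
  refine ((chartPartition d M).locallyFinite.finite_nonempty_inter_compact hK).subset fun c hc => ?_
  obtain ⟨x, hx⟩ : ∃ x, baseIntegrand o η c x ≠ 0 := by
    by_contra! hzero
    exact hc (by simp [hzero])
  obtain ⟨hρ, hηx⟩ := apply_ne_zero_of_baseIntegrand_ne_zero hx
  exact ⟨_, hρ, by_contra fun h => hηx (hηK _ h)⟩

theorem integralM_sub (ho : IsOrientationForm o) (hη : η.IsContinuousOn univ)
    (hηc : η.IsCompactlySupported) (hη' : η'.IsContinuousOn univ)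
    (hηc' : η'.IsCompactlySupported) :
    integralM o (η - η') = integralM o η - integralM o η' := by
  rw [integralM, integralM, integralM,
    ← finsum_sub_distrib (finite_support_integral_baseIntegrand o hηc)
      (finite_support_integral_baseIntegrand o hηc')]
  refine finsum_congr fun c => ?_
  rw [← integral_sub (integrableOn_baseIntegrand ho hη hηc c)
    (integrableOn_baseIntegrand ho hη' hηc' c)]
  refine integral_congr_ae (Filter.Eventually.of_forall fun x => ?_)
  have hsub : (η - η').inChart c x (frame d) = η.inChart c x (frame d) -
    η'.inChart c x (frame d) := rfl
  simp only [baseIntegrand, hsub]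
  ring

theorem integralM_pos (ho : IsOrientationForm o) (hη : η.IsContinuousOn univ)
    (hηc : η.IsCompactlySupported) (hnonneg : ∀ p, 0 ≤ density o η p) {p₀ : M}
    (hpos : 0 < density o η p₀) : 0 < integralM o η := by
  have hintegrand : ∀ c x, 0 ≤ baseIntegrand o η c x := fun c x => by
    rw [baseIntegrand_eq_density_mul_abs (ho.ne_zero _)]
    exact mul_nonneg ((chartPartition d M).nonneg _ _) (mul_nonneg (hnonneg _) (abs_nonneg _))
  obtain ⟨c, hc⟩ := (chartPartition d M).exists_pos_of_mem (mem_univ p₀)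
  have hsource : p₀ ∈ (extChartAt (𝓡 (d + 1)) c).source :=
    tsupport_chartPartition_subset c (subset_tsupport _ hc.ne')
  have htarget := (extChartAt (𝓡 (d + 1)) c).map_source hsource
  have hposAt : 0 < baseIntegrand o η c (extChartAt (𝓡 (d + 1)) c p₀) := by
    rw [baseIntegrand_eq_density_mul_abs (ho.ne_zero _),
      (extChartAt (𝓡 (d + 1)) c).left_inv hsource]
    exact mul_pos hc (mul_pos hpos (abs_pos.2 (inChart_frame_ne_zero htarget (ho.ne_zero _))))
  have hintegral : 0 < ∫ x in (extChartAt (𝓡 (d + 1)) c).target, baseIntegrand o η c x := by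
    rw [setIntegral_pos_iff_support_of_nonneg_ae (Filter.Eventually.of_forall (hintegrand c))
      (integrableOn_baseIntegrand ho hη hηc c)]
    have hopen := (continuousOn_baseIntegrand ho hη c).isOpen_inter_preimage
      (isOpen_extChartAt_target c) (isOpen_Ioi (a := (0 : ℝ)))
    exact (hopen.measure_pos volume ⟨_, htarget, hposAt⟩).trans_le
      (measure_mono fun x hx => ⟨ne_of_gt hx.2, hx.1⟩)
  have hfinite := finite_support_integral_baseIntegrand o hηc
  rw [integralM, finsum_eq_sum _ hfinite]
  exact Finset.sum_pos' (fun c _ => integral_nonneg (hintegrand c))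
    ⟨c, hfinite.mem_toFinset.2 hintegral.ne', hintegral⟩

theorem eq_zero_of_integralM_smul_eq_zero (ho : IsOrientationForm o) (hη : η.IsContinuousOn univ)
    (h : ∀ f : M → ℝ, ContMDiff (𝓡 (d + 1)) 𝓘(ℝ, ℝ) ∞ f → HasCompactSupport f →
      integralM o (fun p => f p • η p) = 0) : η = 0 := by
  funext p₀
  by_contra hp₀
  have hdensity : density o η p₀ ≠ 0 := fun h0 => hp₀ <| by
    refine (density_smul_eq (ho.ne_zero p₀)).trans ?_
    rw [h0]
    exact zero_smul ℝ _
  have hsign : ∀ᶠ p in 𝓝 p₀, 0 < density o η p₀ * density o η p :=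
    (continuous_const.mul (continuous_density ho hη)).continuousAt.eventually
      (lt_mem_nhds (mul_self_pos.2 hdensity))
  obtain ⟨b, -, hb⟩ := (SmoothBumpFunction.nhds_basis_support
    (I := 𝓡 (d + 1)) (c := p₀) Filter.univ_mem).mem_iff.1 hsign
  let f : M → ℝ := fun p => density o η p₀ * b p
  have hf : ContMDiff (𝓡 (d + 1)) 𝓘(ℝ, ℝ) ∞ f := contMDiff_const.mul b.contMDiff
  have hfc : HasCompactSupport f := b.hasCompactSupport.mul_left
  have hfη : ∀ p, density o (fun p => f p • η p) p =
      b p * (density o η p₀ * density o η p) := fun p => by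
    rw [density_smul]
    ring
  refine (integralM_pos ho (DForm.IsContinuousOn.smul hf.continuous hη)
    (DForm.isCompactlySupported_smul hfc η) (fun p => ?_) (p₀ := p₀) ?_).ne' (h f hf hfc)
  · rw [hfη]
    by_cases hp : b p = 0
    · rw [hp, zero_mul]
    · exact mul_nonneg b.nonneg (le_of_lt (hb hp))
  · rw [hfη, b.eq_one, one_mul]
    exact mul_self_pos.2 hdensity

theorem eq_zero_of_integralM_wedge_eq_zero (ho : IsOrientationForm o)
    {ξ : DForm (𝓡 (d + 1)) M d} (hξ : ξ.IsContinuousOn univ)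
    (h : ∀ β : DForm (𝓡 (d + 1)) M 1, β.SmoothOn univ → β.IsCompactlySupported →
      integralM o (β.wedge ξ) = 0) : ξ = 0 := by
  funext p
  by_contra hp
  let η : Model d [⋀^Fin d]→L[ℝ] ℝ := ξ p
  obtain ⟨α, hα⟩ := exists_wedgeOne_ne_zero (η := η) (by simp) hp
  obtain ⟨g, hg, rfl⟩ := exists_differential_eq (I := 𝓡 (d + 1)) p α
  have hdg := smoothOn_differential hg
  refine hα (congrFun (eq_zero_of_integralM_smul_eq_zero ho (hdg.isContinuousOn.wedge hξ)
    fun f hf hfc => ?_) p)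
  have hsmul : (fun p => f p • ((differential (𝓡 (d + 1)) g).wedge ξ) p) =
      DForm.wedge (fun p => f p • differential (𝓡 (d + 1)) g p) ξ :=
    funext fun p => (wedgeOne_smul_left _ _ _).symm
  rw [hsmul]
  exact h _ (hdg.smul hf) (DForm.isCompactlySupported_smul hfc _)

theorem eq_of_forall_integralM_wedge_eq (ho : IsOrientationForm o)
    {J J' : DForm (𝓡 (d + 1)) M d} (hJ : J.IsContinuousOn univ) (hJ' : J'.IsContinuousOn univ)
    (h : ∀ β : DForm (𝓡 (d + 1)) M 1, β.SmoothOn univ → β.IsCompactlySupported →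
      integralM o (β.wedge J) = integralM o (β.wedge J')) : J = J' := by
  refine sub_eq_zero.1 (eq_zero_of_integralM_wedge_eq_zero ho (hJ.sub hJ') fun β hβ hβc => ?_)
  have hsub : β.wedge (J - J') = β.wedge J - β.wedge J' :=
    funext fun p => wedgeOne_sub_right _ _ _
  rw [hsub, integralM_sub ho (hβ.isContinuousOn.wedge hJ) (hβc.wedge_left J)
    (hβ.isContinuousOn.wedge hJ') (hβc.wedge_left J'), h β hβ hβc, sub_self]

end BaseIntegral

section FibreIntegral

variable {d : ℕ} {M : Type*} [TopologicalSpace M] [ChartedSpace (Model d) M]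
  [IsManifold (𝓡 (d + 1)) ∞ M] [T2Space M] [SigmaCompactSpace M]
  {o : DForm (𝓡 (d + 1)) M (d + 1)} {U : Set (TM d M)}
  {θ : DForm (𝓡 (d + 1)).tangent (TM d M) (2 * d)}
  {χ χ' : DForm (𝓡 (d + 1)).tangent (TM d M) 1} {J J' : DForm (𝓡 (d + 1)) M d}

theorem IsFibreIntegral.eq_of_wedge (ho : IsOrientationForm o)
    (hU : IsRegularDomain (𝓡 (d + 1)).tangent U) (hcone : IsConic U) (hθ : IsClosedBasic U θ)
    (hχ : ∀ u ∈ U, ∫ r in Ioi (0 : ℝ), rayCoeff χ u r = 1)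
    (hχ' : ∀ u ∈ U, ∫ r in Ioi (0 : ℝ), rayCoeff χ' u r = 1)
    (hJ : IsFibreIntegral o U (χ.wedge θ) J) (hJ' : IsFibreIntegral o U (χ'.wedge θ) J') :
    J = J' :=
  eq_of_forall_integralM_wedge_eq ho hJ.smooth.isContinuousOn hJ'.smooth.isContinuousOn
    fun β hβ hβc => by
      rw [← hJ.integral_eq β hβ hβc, ← hJ'.integral_eq β hβ hβc]
      exact integralU_wedge_eq hθ hU hcone hχ hχ' (hJ.integrable β hβ hβc)
        (hJ'.integrable β hβ hβc)

theorem IsFibreIntegral.wedge_of_verticalCompactSupport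
    (hU : IsRegularDomain (𝓡 (d + 1)).tangent U) (hcone : IsConic U) (hθ : IsClosedBasic U θ)
    (hχ : ∀ u ∈ U, ∫ r in Ioi (0 : ℝ), rayCoeff χ u r = 1)
    (hχ' : ∀ u ∈ U, ∫ r in Ioi (0 : ℝ), rayCoeff χ' u r = 1) (hχc' : χ'.IsContinuousOn U)
    (hsupp : VerticalCompactSupport U (χ'.wedge θ)) (hJ : IsFibreIntegral o U (χ.wedge θ) J) :
    IsFibreIntegral o U (χ'.wedge θ) J := by
  have hint : ∀ β : DForm (𝓡 (d + 1)) M 1, β.SmoothOn univ → β.IsCompactlySupported →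
      IntegrableU U ((pullbackProj β).wedge (χ'.wedge θ)) := fun β hβ hβc =>
    hsupp.integrableU hU (hχc'.wedge hθ.smooth.isContinuousOn) hβ.isContinuousOn hβc
  exact ⟨hJ.smooth, hint, fun β hβ hβc => (integralU_wedge_eq hθ hU hcone hχ' hχ (hint β hβ hβc)
    (hJ.integrable β hβ hβc)).trans (hJ.integral_eq β hβ hβc)⟩

end FibreIntegral

end VlasovCurrent

open VlasovCurrent in
theorem mainTheorem8_general {d : ℕ} {M : Type*} [TopologicalSpace M] [ChartedSpace (Model d) M]
    [IsManifold (𝓡 (d + 1)) ∞ M] [T2Space M] [SigmaCompactSpace M]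
    (o : DForm (𝓡 (d + 1)) M (d + 1)) (ho : IsOrientationForm o) (U : Set (TM d M))
    (hU : IsRegularDomain (𝓡 (d + 1)).tangent U) (hcone : IsConic U)
    (θ : DForm (𝓡 (d + 1)).tangent (TM d M) (2 * d)) (hθ : IsClosedBasic U θ)
    (χ χ' : DForm (𝓡 (d + 1)).tangent (TM d M) 1)
    (hχc : χ.IsContinuousOn U) (hχc' : χ'.IsContinuousOn U)
    (hχ : ∀ u ∈ U, ∫ c in Ioi (0 : ℝ), rayCoeff χ u c = 1)
    (hχ' : ∀ u ∈ U, ∫ c in Ioi (0 : ℝ), rayCoeff χ' u c = 1) :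
    (∀ J J' : DForm (𝓡 (d + 1)) M d, IsFibreIntegral o U (χ.wedge θ) J →
      IsFibreIntegral o U (χ'.wedge θ) J' → J = J') ∧
    (VerticalCompactSupport U (χ.wedge θ) → VerticalCompactSupport U (χ'.wedge θ) →
      ∀ J : DForm (𝓡 (d + 1)) M d,
        IsFibreIntegral o U (χ.wedge θ) J ↔ IsFibreIntegral o U (χ'.wedge θ) J) :=
  ⟨fun _ _ => IsFibreIntegral.eq_of_wedge ho hU hcone hθ hχ hχ', fun hsupp hsupp' _ =>
    ⟨IsFibreIntegral.wedge_of_verticalCompactSupport hU hcone hθ hχ hχ' hχc' hsupp',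
      IsFibreIntegral.wedge_of_verticalCompactSupport hU hcone hθ hχ' hχ hχc hsupp⟩⟩

theorem mainTheorem8 {d : ℕ} {M : Type*} [TopologicalSpace M]
    [ChartedSpace (VlasovCurrent.Model d) M] [IsManifold (𝓡 (d + 1)) ∞ M]
    [T2Space M] [SigmaCompactSpace M]
    (o : VlasovCurrent.DForm (𝓡 (d + 1)) M (d + 1)) (ho : VlasovCurrent.IsOrientationForm o)
    (U : Set (VlasovCurrent.TM d M)) (hU : VlasovCurrent.IsConicSubbundle U)
    (Ψ : ∀ u : VlasovCurrent.TM d M, ⋀[ℝ]^2 (TangentSpace (𝓡 (d + 1)).tangent u))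
    (hΨ : VlasovCurrent.IsVlasovBivector U Ψ)
    (θ : VlasovCurrent.DForm (𝓡 (d + 1)).tangent (VlasovCurrent.TM d M) (2 * d))
    (hθs : θ.SmoothOn U) (hθ : VlasovCurrent.TransportEquations U Ψ θ)
    (χ χ' : VlasovCurrent.DForm (𝓡 (d + 1)).tangent (VlasovCurrent.TM d M) 1)
    (hχ : VlasovCurrent.IsSupportForm U χ) (hχ' : VlasovCurrent.IsSupportForm U χ') :
    (∀ J J' : VlasovCurrent.DForm (𝓡 (d + 1)) M d,
      VlasovCurrent.IsFibreIntegral o U (χ.wedge θ) J →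
      VlasovCurrent.IsFibreIntegral o U (χ'.wedge θ) J' → J = J') ∧
    (VlasovCurrent.VerticalCompactSupport U (χ.wedge θ) →
      VlasovCurrent.VerticalCompactSupport U (χ'.wedge θ) →
      ∀ J : VlasovCurrent.DForm (𝓡 (d + 1)) M d,
        VlasovCurrent.IsFibreIntegral o U (χ.wedge θ) J ↔
          VlasovCurrent.IsFibreIntegral o U (χ'.wedge θ) J) :=
  mainTheorem8_general o ho U hU.isRegularDomain hU.isConic θ
    ⟨hθs, hθ.closed, hθ.interiorZero_radial hΨ⟩ χ χ' hχ.smooth.isContinuousOn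
    hχ'.smooth.isContinuousOn hχ.integral_eq_one hχ'.integral_eq_one
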